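/- Let $(u,v)=u_1v_1+u_2v_2$ be the standard complex bilinear form on $\mathbb{C}^2$. Let $m\ge 1$ and $n\ge 0$ be integers. A configuration $\mathcal{A}$ of type $(m,1^n)$ consists of $n+1$ pairwise non-collinear vectors $\alpha_0,\dots,\alpha_n\in\mathbb{C}^2$ with $(\alpha_i,\alpha_i)\neq 0$, taken with multiplicities $m_0=m$ and $m_1=\dots=m_n=1$. It admits the Baker–Akhiezer function if there is a function $\phi(\lambda,x)$ of $\lambda,x\in\mathbb{C}^2$ such that 1. $\phi(\lambda,x)=P(\lambda,x)e^{(\lambda,x)}$, where $P$ is a polynomial in $\lambda$ and $x$ with highest term (the homogeneous component of highest total degree) $\prod_{i=0}^n(\alpha_i,\lambda)^{m_i}(\alpha_i,x)^{m_i}$; 2. for every $0\le i\le n$ and every $1\le s\le m_i$ one has $\left(\alpha_i,\frac{\partial}{\partial x}\right)^{2s-1}\phi(\lambda,x)=0$ for all $\lambda$ and all $x$ with $(\alpha_i,x)=0$. Two configurations are equivalent if, up to numbering of the vectors, one is obtained from the other by a complex orthogonal transformation of $\mathbb{C}^2$ and by multiplying the vectors by non-zero complex scalars, with the multiplicities kept.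 A configuration of type $(m,1^n)$ is called the configuration $\mathcal{A}_{(m,1^n)}$ if $\alpha_0=(1,0)$ and there are $\varphi_1,\dots,\varphi_n\in\mathbb{C}$ such that $\alpha_j=(\cos\varphi_j,\sin\varphi_j)$ for $1\le j\le n$ and the elementary symmetric functions $e_k$ of $z_j=e^{2i\varphi_j}$, $1\le j\le n$, are $$e_k=(-1)^k\binom{n}{k}\binom{m+k-1}{k}\binom{m+n-1}{k}^{-1},\qquad 1\le k\le n.$$ **Theorem.** For all integers $m\ge1$ and $n\ge0$ the configuration $\mathcal{A}_{(m,1^n)}$ exists, and a configuration $\mathcal{A}$ of type $(m,1^n)$ admits the Baker–Akhiezer function if and only if $\mathcal{A}$ is equivalent to $\mathcal{A}_{(m,1^n)}$. -/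

import Mathlib

open scoped Matrix

noncomputable section

/-- A finite configuration of `n + 1` vectors in `ℂ ^ N` with positive integer multiplicities. The
vectors are pairwise non-collinear (over `ℂ`) and non-isotropic for the standard complex bilinear
form `(u, v) = ∑ u_k v_k`, which is `u ⬝ᵥ v`. -/
structure Configuration (N n : ℕ) where
  /-- the vectors `α_0, …, α_n` -/
  vec : Fin (n + 1) → Fin N → ℂ
  /-- the multiplicities `m_0, …, m_n` -/
  mult : Fin (n + 1) → ℕ
  mult_pos : ∀ i, 1 ≤ mult i
  noncollinear : ∀ i j, i ≠ j → LinearIndependent ℂ ![vec i, vec j]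
  nonisotropic : ∀ i, vec i ⬝ᵥ vec i ≠ 0

namespace Configuration

variable {N n : ℕ}

/-- The polynomial `∏ (α_i, lam)^{m_i} (α_i, x)^{m_i}` in the coordinates of `lam` (variables
`Sum.inl k`) and of `x` (variables `Sum.inr k`). -/
def highestTerm (A : Configuration N n) : MvPolynomial (Fin N ⊕ Fin N) ℂ :=
  ∏ i, ((∑ k, MvPolynomial.C (A.vec i k) * MvPolynomial.X (Sum.inl k)) ^ A.mult i *
    (∑ k, MvPolynomial.C (A.vec i k) * MvPolynomial.X (Sum.inr k)) ^ A.mult i)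

/-- `φ` is a Baker-Akhiezer function of the configuration:
* `φ(lam, x) = P(lam, x) exp (lam, x)` with a polynomial `P` in `lam` and `x` that differs from
  `∏ (α_i, lam)^{m_i} (α_i, x)^{m_i}`, homogeneous of degree `2 ∑ m_i`, by terms of lower degree;
* for `1 ≤ s ≤ m_i` the directional derivative `(α_i, ∂/∂x)^{2s-1} φ` vanishes on the hyperplane
  `(α_i, x) = 0`. The `k`-th directional derivative at `x` along `α_i` is the `k`-th derivative of
  `t ↦ φ(lam, x + t α_i)` at `t = 0`. -/
def IsBakerAkhiezer (A : Configuration N n) (φ : (Fin N → ℂ) → (Fin N → ℂ) → ℂ) : Prop :=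
  (∃ P : MvPolynomial (Fin N ⊕ Fin N) ℂ,
    (P - A.highestTerm).totalDegree < 2 * ∑ i, A.mult i ∧
    ∀ lam x, φ lam x = MvPolynomial.eval (Sum.elim lam x) P * Complex.exp (lam ⬝ᵥ x)) ∧
  ∀ (i : Fin (n + 1)) (s : ℕ), 1 ≤ s → s ≤ A.mult i →
    ∀ lam x : Fin N → ℂ, A.vec i ⬝ᵥ x = 0 →
      iteratedDeriv (2 * s - 1) (fun t : ℂ => φ lam (x + t • A.vec i)) 0 = 0

/-- The configuration admits the Baker-Akhiezer function. -/
def AdmitsBA (A : Configuration N n) : Prop :=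
  ∃ φ : (Fin N → ℂ) → (Fin N → ℂ) → ℂ, A.IsBakerAkhiezer φ

/-- Equivalence of configurations: up to the numbering of the vectors, one is obtained from the
other by a complex orthogonal transformation and by multiplying the vectors by non-zero complex
scalars, with the multiplicities kept. -/
def Equivalent (A B : Configuration N n) : Prop :=
  ∃ (O : Matrix (Fin N) (Fin N) ℂ) (σ : Equiv.Perm (Fin (n + 1))) (c : Fin (n + 1) → ℂ),
    Oᵀ * O = 1 ∧ (∀ i, c i ≠ 0) ∧
    ∀ i, B.vec (σ i) = c i • (O *ᵥ A.vec i) ∧ B.mult (σ i) = A.mult i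

/-- Type `(m, 1^n)`: `m_0 = m` and `m_1 = … = m_n = 1`. -/
def HasType (A : Configuration N n) (m : ℕ) : Prop :=
  A.mult 0 = m ∧ ∀ i : Fin n, A.mult i.succ = 1

/-- `A` is the configuration `A_{(m, 1^n)}`: it has type `(m, 1^n)`, `α_0 = (1, 0)`, and
`α_i = (cos φ_i, sin φ_i)` (`φ_i` complex, `1 ≤ i ≤ n`), where the elementary symmetric functions
`e_k` of `z_i = exp (2 √-1 φ_i)`, `1 ≤ i ≤ n`, have the values
`(-1)^k binom(n, k) binom(m + k - 1, k) / binom(m + n - 1, k)` for `1 ≤ k ≤ n`. -/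
def IsAm1n (A : Configuration 2 n) (m : ℕ) : Prop :=
  A.HasType m ∧ A.vec 0 = ![1, 0] ∧
  ∃ φ : Fin n → ℂ,
    (∀ i : Fin n, A.vec i.succ = ![Complex.cos (φ i), Complex.sin (φ i)]) ∧
    ∀ k : ℕ, 1 ≤ k → k ≤ n →
      ((Finset.univ : Finset (Fin n)).val.map
          fun i => Complex.exp (2 * Complex.I * φ i)).esymm k =
        (-1) ^ k * (n.choose k : ℂ) * ((m + k - 1).choose k : ℂ) / ((m + n - 1).choose k : ℂ)

end Configuration

end

/-!
The theorem goes through a system of equations of Stieltjes type. Say that the vector `α_i` is in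
equilibrium if `∑_{j ≠ i} m_j cot (φ_j - φ_i) = 0` (`IsEquilibrium`). A configuration of type
`(m, 1^n)` with `α_0 = (1, 0)` admits the Baker-Akhiezer function if and only if the `n` vectors of
multiplicity one are in equilibrium, and these equations have one solution up to numbering.

After division by the exponential, the conditions on `φ = P exp (lam, x)` say that the odd powers
of `(α_i, ∂/∂x) + (α_i, lam)` map `P` to multiples of `(α_i, x)` (`IsQuasiInvariant`,
`admitsBA_iff`).

*Necessity* (`isEquilibrium_of_admitsBA`). The highest component of a quasi-invariant of order `m`
is divisible by the `m`-th power of the linear form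
(`IsQuasiInvariant.pow_dvd_homogeneousComponent`). Let `m_i = 1` and let `lam` run through the
multiples of the vector orthogonal to `α_i`. The highest term of `P` vanishes, the next component
`f` becomes the highest one, and `f = g ∏_{j ≠ i} (α_j, x)^{m_j}`. On the line `(α_i, x) = 0` the
factor `g` is a non-zero constant and the normal derivative of `f` vanishes; the logarithmic
derivative of the product gives the equilibrium equation.

*Uniqueness* (`isBethe_iff`). With `z_j = exp (2 i φ_j)` the equations say that `Q = ∏ (X - z_j)`
is annihilated by a second order differential operator. This is a recursion for the coefficients of
`Q`, solved by `Q = gegenbauerPoly m n`, that is, by the prescribed elementary symmetric functions.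
Conversely, the roots of `gegenbauerPoly m n` differ from `0` and `1` because its coefficients are
positive, and they are simple by the differential equation (`exists_roots_gegenbauerPoly`), so that
the configuration exists. The
equations are invariant under `z ↦ 1 / z`, hence the solution is symmetric with respect to the
reflection in the line `(α_0, x) = 0` (`exists_perm_inv`).

*Sufficiency* (`admitsBA_of_calogeroStep`). By Berest's formula the Baker-Akhiezer function is,
up to a constant, the result of applying the operator
`Δ - ∑ 2 m_j / (α_j, x) (α_j, ∂/∂x) - (lam, lam)` to `∏ (α_j, x)^{2 m_j} exp (lam, x)`
as many times as the sum of the multiplicities. It remains to see that the operator preserves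
quasi-invariance: at a line of multiplicity one this follows from equilibrium
(`isQuasiInvariant_calogeroStep_of_isEquilibrium`), at the line of multiplicity `m` from the
reflection symmetry (`isQuasiInvariant_calogeroStep_of_symmetric`).
-/

/-! ### Linear forms, directional derivatives and restriction to a hyperplane -/

namespace BakerAkhiezer

open MvPolynomial

/-- Polynomials in the coordinates of `lam` (variables `Sum.inl k`) and of `x`
(variables `Sum.inr k`). -/
abbrev Poly (N : ℕ) : Type := MvPolynomial (Fin N ⊕ Fin N) ℂ

variable {N : ℕ}

/-- The linear form `(v, x)`. -/
noncomputable def xForm (v : Fin N → ℂ) : Poly N := ∑ k, C (v k) * X (Sum.inr k)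

/-- The linear form `(v, lam)`. -/
noncomputable def lamForm (v : Fin N → ℂ) : Poly N := ∑ k, C (v k) * X (Sum.inl k)

/-- The directional derivative `(v, ∂/∂x)`. -/
noncomputable def xDeriv (v : Fin N → ℂ) : Derivation ℂ (Poly N) (Poly N) :=
  mkDerivation ℂ (Sum.elim (fun _ => 0) (fun k => C (v k)))

/-- The operator `p ↦ (v, ∂/∂x) p + l p`. For `l = (v, lam)` it is the conjugate of `(v, ∂/∂x)` by
multiplication with `exp (lam, x)`. Other linear forms `l` occur when `lam` is specialised to
multiples of a fixed vector. -/
noncomputable def twist (l : Poly N) (v : Fin N → ℂ) : Poly N →ₗ[ℂ] Poly N :=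
  (xDeriv v).toLinearMap + LinearMap.mulLeft ℂ l

/-- Quasi-invariance of order `m` at the hyperplane `(a, x) = 0`: the odd powers
`1, 3, …, 2m - 1` of `twist l a` map `p` to multiples of `(a, x)`. -/
def IsQuasiInvariant (l : Poly N) (a : Fin N → ℂ) (m : ℕ) (p : Poly N) : Prop :=
  ∀ s < m, xForm a ∣ (twist l a)^[2 * s + 1] p

/-- Restriction to the hyperplane `(a, x) = 0`, as the substitution of the orthogonal projection
`x - ((a, x) / (a, a)) a` for `x`. Its image lies in a polynomial ring, and its kernel is generated
by `(a, x)` (`hyperRestrict_eq_zero_iff`). -/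
noncomputable def hyperRestrict (a : Fin N → ℂ) : Poly N →ₐ[ℂ] Poly N :=
  aeval (Sum.elim (fun k => X (Sum.inl k))
    (fun k => X (Sum.inr k) - C (a k / (a ⬝ᵥ a)) * xForm a))

theorem twist_apply (l : Poly N) (v : Fin N → ℂ) (p : Poly N) :
    twist l v p = xDeriv v p + l * p := rfl

theorem eval_xForm (v lam x : Fin N → ℂ) : eval (Sum.elim lam x) (xForm v) = v ⬝ᵥ x := by
  simp [xForm, dotProduct]

theorem eval_lamForm (v lam x : Fin N → ℂ) : eval (Sum.elim lam x) (lamForm v) = v ⬝ᵥ lam := by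
  simp [lamForm, dotProduct]

theorem xForm_add (v w : Fin N → ℂ) : xForm (v + w) = xForm v + xForm w := by
  simp [xForm, add_mul, Finset.sum_add_distrib]

theorem xForm_smul (c : ℂ) (v : Fin N → ℂ) : xForm (c • v) = C c * xForm v := by
  simp [xForm, Finset.mul_sum, mul_assoc]

theorem lamForm_add (v w : Fin N → ℂ) : lamForm (v + w) = lamForm v + lamForm w := by
  simp [lamForm, add_mul, Finset.sum_add_distrib]

theorem lamForm_smul (c : ℂ) (v : Fin N → ℂ) : lamForm (c • v) = C c * lamForm v := by
  simp [lamForm, Finset.mul_sum, mul_assoc]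

theorem xDeriv_X_inl (v : Fin N → ℂ) (k : Fin N) : xDeriv v (X (Sum.inl k)) = 0 := by
  simp [xDeriv]

theorem xDeriv_X_inr (v : Fin N → ℂ) (k : Fin N) : xDeriv v (X (Sum.inr k)) = C (v k) := by
  simp [xDeriv]

theorem xDeriv_mul (v : Fin N → ℂ) (p q : Poly N) :
    xDeriv v (p * q) = xDeriv v p * q + p * xDeriv v q := by
  rw [Derivation.leibniz, smul_eq_mul, smul_eq_mul]; ring

theorem xDeriv_C (v : Fin N → ℂ) (c : ℂ) : xDeriv v (C c) = 0 := by
  simp [xDeriv]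

theorem xDeriv_xForm (v w : Fin N → ℂ) : xDeriv v (xForm w) = C (v ⬝ᵥ w) := by
  simp [xForm, xDeriv_X_inr, dotProduct, mul_comm]

theorem xDeriv_lamForm (v w : Fin N → ℂ) : xDeriv v (lamForm w) = 0 := by
  simp [lamForm, xDeriv_X_inl]

theorem xDeriv_add_left (v w : Fin N → ℂ) : xDeriv (v + w) = xDeriv v + xDeriv w := by
  apply MvPolynomial.derivation_ext
  rintro (k | k) <;> simp [xDeriv_X_inl, xDeriv_X_inr]

theorem xDeriv_smul_left (c : ℂ) (v : Fin N → ℂ) : xDeriv (c • v) = c • xDeriv v := by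
  apply MvPolynomial.derivation_ext
  rintro (k | k) <;> simp [xDeriv_X_inl, xDeriv_X_inr, MvPolynomial.smul_eq_C_mul]

theorem xDeriv_comm (v w : Fin N → ℂ) (p : Poly N) :
    xDeriv v (xDeriv w p) = xDeriv w (xDeriv v p) := by
  have h : ⁅xDeriv v, xDeriv w⁆ = 0 := by
    apply MvPolynomial.derivation_ext
    rintro (k | k) <;> simp [Derivation.commutator_apply, xDeriv_X_inl, xDeriv_X_inr]
  have := congrArg (fun D => D p) h
  simpa [Derivation.commutator_apply, sub_eq_zero] using this

theorem xForm_isHomogeneous (v : Fin N → ℂ) : (xForm v).IsHomogeneous 1 :=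
  IsHomogeneous.sum _ _ _ fun _ _ => isHomogeneous_C_mul_X _ _

theorem lamForm_isHomogeneous (v : Fin N → ℂ) : (lamForm v).IsHomogeneous 1 :=
  IsHomogeneous.sum _ _ _ fun _ _ => isHomogeneous_C_mul_X _ _

/-! #### Restriction to a hyperplane -/

theorem hyperRestrict_X_inl (a : Fin N → ℂ) (k : Fin N) :
    hyperRestrict a (X (Sum.inl k)) = X (Sum.inl k) := by simp [hyperRestrict]

theorem hyperRestrict_lamForm (a v : Fin N → ℂ) : hyperRestrict a (lamForm v) = lamForm v := by
  simp [hyperRestrict, lamForm, algebraMap_eq]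

theorem hyperRestrict_C (a : Fin N → ℂ) (c : ℂ) : hyperRestrict a (C c) = C c := by
  simp [hyperRestrict, algebraMap_eq]

theorem hyperRestrict_xForm (a v : Fin N → ℂ) :
    hyperRestrict a (xForm v) = xForm v - C ((a ⬝ᵥ v) / (a ⬝ᵥ a)) * xForm a := by
  have : C ((a ⬝ᵥ v) / (a ⬝ᵥ a)) * xForm a
      = ∑ k, C (v k) * (C (a k / (a ⬝ᵥ a)) * xForm a) := by
    rw [dotProduct, Finset.sum_div, map_sum, Finset.sum_mul]
    refine Finset.sum_congr rfl fun k _ => ?_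
    rw [← mul_assoc, ← C_mul]; congr 2; ring
  rw [this]
  conv_lhs => rw [xForm]
  conv_rhs => rw [xForm]
  rw [← Finset.sum_sub_distrib, map_sum]
  refine Finset.sum_congr rfl fun k _ => ?_
  rw [map_mul, hyperRestrict_C, ← mul_sub]
  simp [hyperRestrict]

theorem hyperRestrict_self {a : Fin N → ℂ} (ha : a ⬝ᵥ a ≠ 0) : hyperRestrict a (xForm a) = 0 := by
  rw [hyperRestrict_xForm, div_self ha]; simp

theorem eval_hyperRestrict (a lam x : Fin N → ℂ) (p : Poly N) :
    eval (Sum.elim lam x) (hyperRestrict a p)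
      = eval (Sum.elim lam (x - ((a ⬝ᵥ x) / (a ⬝ᵥ a)) • a)) p := by
  have : (aeval (Sum.elim lam x) : Poly N →ₐ[ℂ] ℂ).comp (hyperRestrict a)
      = aeval (Sum.elim lam (x - ((a ⬝ᵥ x) / (a ⬝ᵥ a)) • a)) := by
    apply MvPolynomial.algHom_ext
    rintro (k | k)
    · simp [hyperRestrict]
    · simp only [AlgHom.comp_apply, hyperRestrict, aeval_X, Sum.elim_inr, map_sub, map_mul,
        Pi.sub_apply, Pi.smul_apply, smul_eq_mul]
      have h1 : aeval (Sum.elim lam x) (xForm a) = a ⬝ᵥ x := by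
        rw [← eval_xForm a lam x, ← coe_aeval_eq_eval]; rfl
      rw [h1]
      simp; ring
  simpa [coe_aeval_eq_eval] using congrArg (fun f => f p) this

theorem hyperRestrict_eq_zero_iff {a : Fin N → ℂ} (ha : a ⬝ᵥ a ≠ 0) {p : Poly N} :
    hyperRestrict a p = 0 ↔ xForm a ∣ p := by
  constructor
  · intro h
    have key : (Ideal.Quotient.mkₐ ℂ (Ideal.span {xForm a})).comp (hyperRestrict a)
        = Ideal.Quotient.mkₐ ℂ (Ideal.span {xForm a}) := by
      apply MvPolynomial.algHom_ext
      rintro (k | k)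
      · simp [hyperRestrict]
      · simp only [AlgHom.comp_apply, hyperRestrict, aeval_X, Sum.elim_inr, map_sub, map_mul]
        have : Ideal.Quotient.mkₐ ℂ (Ideal.span {xForm a}) (xForm a) = 0 := by
          rw [Ideal.Quotient.mkₐ_eq_mk, Ideal.Quotient.eq_zero_iff_mem]
          exact Ideal.mem_span_singleton_self _
        rw [this]; simp
    have h2 := congrArg (fun f => f p) key
    simp only [AlgHom.comp_apply, h, map_zero, Ideal.Quotient.mkₐ_eq_mk] at h2
    exact Ideal.mem_span_singleton.mp (Ideal.Quotient.eq_zero_iff_mem.mp h2.symm)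
  · rintro ⟨q, rfl⟩
    rw [map_mul, hyperRestrict_self ha, zero_mul]

/-- A polynomial is divisible by `(a, x)` as soon as it vanishes on the hyperplane. -/
theorem xForm_dvd_iff_eval {a : Fin N → ℂ} (ha : a ⬝ᵥ a ≠ 0) {p : Poly N} :
    xForm a ∣ p ↔ ∀ lam x : Fin N → ℂ, a ⬝ᵥ x = 0 → eval (Sum.elim lam x) p = 0 := by
  constructor
  · rintro ⟨q, rfl⟩ lam x hx
    rw [map_mul, eval_xForm, hx, zero_mul]
  · intro h
    rw [← hyperRestrict_eq_zero_iff ha]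
    apply MvPolynomial.funext
    intro y
    obtain ⟨lam, x, rfl⟩ : ∃ lam x, y = Sum.elim lam x :=
      ⟨y ∘ Sum.inl, y ∘ Sum.inr, (Sum.elim_comp_inl_inr y).symm⟩
    rw [eval_hyperRestrict, map_zero]
    apply h
    rw [dotProduct_sub, dotProduct_smul, smul_eq_mul, div_mul_cancel₀ _ ha, sub_self]

theorem xForm_ne_zero {v : Fin N → ℂ} (hv : v ≠ 0) : xForm v ≠ 0 := by
  intro h
  apply hv
  funext k
  have := eval_xForm v 0 (Pi.single k 1)
  rw [h] at this
  simpa using this.symm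

theorem ne_zero_of_nonisotropic {a : Fin N → ℂ} (ha : a ⬝ᵥ a ≠ 0) : a ≠ 0 := by
  rintro rfl; simp at ha

theorem xForm_prime {a : Fin N → ℂ} (ha : a ⬝ᵥ a ≠ 0) : Prime (xForm a) := by
  refine ⟨xForm_ne_zero (ne_zero_of_nonisotropic ha), ?_, ?_⟩
  · intro h
    have := h.map (hyperRestrict a)
    rw [hyperRestrict_self ha] at this
    exact not_isUnit_zero this
  · intro p q h
    rw [← hyperRestrict_eq_zero_iff ha, map_mul, mul_eq_zero] at h
    simpa only [hyperRestrict_eq_zero_iff ha] using h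

/-! #### The twisted derivatives -/

theorem twist_xForm_mul (l : Poly N) (v w : Fin N → ℂ) (p : Poly N) :
    twist l v (xForm w * p) = C (v ⬝ᵥ w) * p + xForm w * twist l v p := by
  rw [twist_apply, twist_apply, xDeriv_mul, xDeriv_xForm]; ring

theorem twist_C_mul (l : Poly N) (v : Fin N → ℂ) (c : ℂ) (p : Poly N) :
    twist l v (C c * p) = C c * twist l v p := by
  rw [← MvPolynomial.smul_eq_C_mul, map_smul, MvPolynomial.smul_eq_C_mul]

theorem twist_comm (v w : Fin N → ℂ) (p : Poly N) :
    twist (lamForm v) v (twist (lamForm w) w p) = twist (lamForm w) w (twist (lamForm v) v p) := by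
  simp only [twist_apply, map_add, xDeriv_mul, xDeriv_lamForm]
  rw [xDeriv_comm]; ring

theorem iterate_twist_xForm_mul (l : Poly N) (v w : Fin N → ℂ) (k : ℕ) (p : Poly N) :
    (twist l v)^[k + 1] (xForm w * p)
      = C ((k + 1) * (v ⬝ᵥ w)) * (twist l v)^[k] p + xForm w * (twist l v)^[k + 1] p := by
  induction k with
  | zero => simp [twist_xForm_mul]
  | succ k ih =>
    rw [Function.iterate_succ_apply', ih, map_add, twist_C_mul, twist_xForm_mul,
      ← Function.iterate_succ_apply' (twist l v), ← Function.iterate_succ_apply' (twist l v)]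
    simp only [Nat.succ_eq_add_one, Nat.cast_add, Nat.cast_one, C_mul, map_add, C_1]
    ring

theorem iterate_twist_add (l : Poly N) (v : Fin N → ℂ) (k : ℕ) (p q : Poly N) :
    (twist l v)^[k] (p + q) = (twist l v)^[k] p + (twist l v)^[k] q :=
  iterate_map_add (twist l v) k p q

theorem iterate_twist_smul (l : Poly N) (v : Fin N → ℂ) (k : ℕ) (c : ℂ) (p : Poly N) :
    (twist l v)^[k] (C c * p) = C c * (twist l v)^[k] p := by
  induction k with
  | zero => simp
  | succ k ih => rw [Function.iterate_succ_apply', ih, twist_C_mul, Function.iterate_succ_apply']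

end BakerAkhiezer

/-! ### Homogeneous components and highest terms of quasi-invariants -/

namespace BakerAkhiezer

open MvPolynomial

variable {N : ℕ}

theorem homogeneousComponent_map_eq (T : Poly N →ₗ[ℂ] Poly N) {d d' : ℕ}
    (h : ∀ j (p : Poly N), p.IsHomogeneous j →
      homogeneousComponent d (T p) = if j = d' then T p else 0) (p : Poly N) :
    homogeneousComponent d (T p) = T (homogeneousComponent d' p) := by
  have hp : ∀ j, homogeneousComponent d (T (homogeneousComponent j p))
      = T (homogeneousComponent d' (homogeneousComponent j p)) := by
    intro j
    have hj := homogeneousComponent_isHomogeneous j p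
    rw [h j _ hj, homogeneousComponent_of_mem hj]
    by_cases hd : j = d'
    · simp [hd]
    · simp [hd, Ne.symm hd]
  conv_lhs => rw [← sum_homogeneousComponent p]
  conv_rhs => rw [← sum_homogeneousComponent p]
  simp only [map_sum]
  exact Finset.sum_congr rfl fun j _ => hp j

theorem homogeneousComponent_mul_linear {l : Poly N} (hl : l.IsHomogeneous 1) (d : ℕ)
    (p : Poly N) : homogeneousComponent (d + 1) (l * p) = l * homogeneousComponent d p := by
  refine homogeneousComponent_map_eq (LinearMap.mulLeft ℂ l) (fun j q hq => ?_) p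
  rw [LinearMap.mulLeft_apply, homogeneousComponent_of_mem (hl.mul hq)]
  have : d + 1 = 1 + j ↔ j = d := by omega
  simp [this]

theorem xDeriv_eq_sum (v : Fin N → ℂ) (p : Poly N) :
    xDeriv v p = ∑ k, C (v k) * pderiv (Sum.inr k) p := by
  induction p using MvPolynomial.induction_on with
  | C c => simp
  | add p q hp hq => simp only [map_add, hp, hq, mul_add, Finset.sum_add_distrib]
  | mul_X p i hp =>
    rw [xDeriv_mul, hp]
    simp only [pderiv_mul, mul_add, Finset.sum_add_distrib, Finset.sum_mul]
    congr 1
    · exact Finset.sum_congr rfl fun k _ => by ring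
    · rcases i with k | k
      · simp [xDeriv_X_inl, pderiv_X]
      · simp [xDeriv_X_inr, pderiv_X, Pi.single_apply, mul_comm]

theorem isHomogeneous_xDeriv (v : Fin N → ℂ) {p : Poly N} {j : ℕ} (hp : p.IsHomogeneous j) :
    (xDeriv v p).IsHomogeneous (j - 1) := by
  rw [xDeriv_eq_sum]
  exact IsHomogeneous.sum _ _ _ fun k _ => (hp.pderiv).C_mul _

theorem homogeneousComponent_xDeriv (v : Fin N → ℂ) (d : ℕ) (p : Poly N) :
    homogeneousComponent d (xDeriv v p) = xDeriv v (homogeneousComponent (d + 1) p) := by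
  refine homogeneousComponent_map_eq (xDeriv v).toLinearMap (fun j q hq => ?_) p
  change homogeneousComponent d (xDeriv v q) = if j = d + 1 then xDeriv v q else 0
  rcases j with _ | j
  · obtain ⟨c, rfl⟩ : ∃ c, q = C c := ⟨coeff 0 q, by
      rw [← homogeneousComponent_zero, homogeneousComponent_eq_self hq]⟩
    simp
  · rw [homogeneousComponent_of_mem (isHomogeneous_xDeriv v hq)]
    simp [eq_comm]

theorem homogeneousComponent_twist {l : Poly N} (hl : l.IsHomogeneous 1) (v : Fin N → ℂ) (d : ℕ)
    (p : Poly N) : homogeneousComponent (d + 1) (twist l v p)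
      = xDeriv v (homogeneousComponent (d + 2) p) + l * homogeneousComponent d p := by
  rw [twist_apply, map_add, homogeneousComponent_xDeriv, homogeneousComponent_mul_linear hl]

theorem xForm_dvd_homogeneousComponent {v : Fin N → ℂ} {p : Poly N} (h : xForm v ∣ p) (d : ℕ) :
    xForm v ∣ homogeneousComponent (d + 1) p := by
  obtain ⟨q, rfl⟩ := h
  rw [homogeneousComponent_mul_linear (xForm_isHomogeneous v)]
  exact dvd_mul_right _ _

theorem xForm_dvd_C_mul_iff {v : Fin N → ℂ} {c : ℂ} (hc : c ≠ 0) {p : Poly N} :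
    xForm v ∣ C c * p ↔ xForm v ∣ p :=
  (((isUnit_iff_ne_zero.mpr hc).map (C : ℂ →+* Poly N)).dvd_mul_left)

/-- The quotient `q` in `twist l a p = (a, x) q` is quasi-invariant of one order less than `p`. -/
theorem IsQuasiInvariant.quotient {l : Poly N} {a : Fin N → ℂ} (ha : a ⬝ᵥ a ≠ 0) {m : ℕ}
    {p q : Poly N} (hp : IsQuasiInvariant l a (m + 1) p) (hq : twist l a p = xForm a * q) :
    IsQuasiInvariant l a m q := by
  intro s hs
  have h := hp (s + 1) (by omega)
  rw [Function.iterate_succ_apply, hq, show 2 * (s + 1) = (2 * s + 1) + 1 by ring,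
    iterate_twist_xForm_mul, dvd_add_left (dvd_mul_right _ _), xForm_dvd_C_mul_iff] at h
  · exact h
  · refine mul_ne_zero ?_ ha
    exact_mod_cast Nat.succ_ne_zero (2 * s + 1)

/-- The highest component of a quasi-invariant of order `m` is divisible by `(a, x) ^ m`. The
components of one parity of the degree are independent of the others, so only
`D + 2, D + 4, …` have to vanish. The proof divides the highest component of the identity
`twist l a p = (a, x) q` and uses induction for `q`. -/
theorem IsQuasiInvariant.pow_dvd_homogeneousComponent {l : Poly N} (hl : l.IsHomogeneous 1)
    {a : Fin N → ℂ} (ha : a ⬝ᵥ a ≠ 0) (hla : ¬ xForm a ∣ l) (D m : ℕ) {p : Poly N}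
    (hp : IsQuasiInvariant l a m p) (hD : ∀ k, homogeneousComponent (D + 2 * (k + 1)) p = 0) :
    xForm a ^ m ∣ homogeneousComponent D p := by
  induction m generalizing p with
  | zero => simp
  | succ m ih =>
    obtain ⟨q, hq⟩ : xForm a ∣ twist l a p := hp 0 (by omega)
    have key : ∀ k, l * homogeneousComponent (D + 2 * k) p
        = xForm a * homogeneousComponent (D + 2 * k) q := by
      intro k
      have := congrArg (homogeneousComponent (D + 2 * k + 1)) hq
      rw [homogeneousComponent_twist hl, homogeneousComponent_mul_linear (xForm_isHomogeneous a),
        show D + 2 * k + 2 = D + 2 * (k + 1) by ring, hD k, map_zero, zero_add] at this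
      exact this
    have hq' := ih (hp.quotient ha hq) fun k => by
      have := key (k + 1)
      rw [hD k, mul_zero, zero_eq_mul] at this
      exact this.resolve_left (xForm_prime ha).ne_zero
    refine (xForm_prime ha).pow_dvd_of_dvd_mul_left (m + 1) hla ?_
    have h0 := key 0
    rw [mul_zero, add_zero] at h0
    rw [h0, pow_succ']
    exact mul_dvd_mul_left _ hq'

end BakerAkhiezer

/-! ### The Baker-Akhiezer conditions as divisibility conditions -/

namespace BakerAkhiezer

open MvPolynomial

variable {N n : ℕ}

theorem hasDerivAt_eval_line (p : Poly N) (lam x v : Fin N → ℂ) (t : ℂ) :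
    HasDerivAt (fun t : ℂ => eval (Sum.elim lam (x + t • v)) p)
      (eval (Sum.elim lam (x + t • v)) (xDeriv v p)) t := by
  induction p using MvPolynomial.induction_on with
  | C c => simpa using hasDerivAt_const t c
  | add p q hp hq =>
    simp only [map_add]
    exact hp.add hq
  | mul_X p i hp =>
    have hX : HasDerivAt (fun t : ℂ => eval (Sum.elim lam (x + t • v)) (X i : Poly N))
        (eval (Sum.elim lam (x + t • v)) (xDeriv v (X i))) t := by
      rcases i with k | k
      · simpa [xDeriv_X_inl] using hasDerivAt_const t (lam k)
      · simpa [xDeriv_X_inr] using ((hasDerivAt_id t).mul_const (v k)).const_add (x k)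
    simp only [xDeriv_mul, map_add, map_mul]
    exact hp.mul hX

theorem hasDerivAt_eval_mul_exp (p : Poly N) (lam x v : Fin N → ℂ) (t : ℂ) :
    HasDerivAt
      (fun t : ℂ => eval (Sum.elim lam (x + t • v)) p * Complex.exp (lam ⬝ᵥ (x + t • v)))
      (eval (Sum.elim lam (x + t • v)) (twist (lamForm v) v p)
        * Complex.exp (lam ⬝ᵥ (x + t • v))) t := by
  have h1 : HasDerivAt (fun t : ℂ => lam ⬝ᵥ (x + t • v)) (lam ⬝ᵥ v) t := by
    simpa [dotProduct_add, dotProduct_smul] using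
      ((hasDerivAt_id t).mul_const (lam ⬝ᵥ v)).const_add (lam ⬝ᵥ x)
  refine ((hasDerivAt_eval_line p lam x v t).mul h1.cexp).congr_deriv ?_
  rw [twist_apply, map_add, map_mul, eval_lamForm, dotProduct_comm v lam]
  ring

theorem iteratedDeriv_eval_mul_exp (k : ℕ) (p : Poly N) (lam x v : Fin N → ℂ) :
    iteratedDeriv k
      (fun t : ℂ => eval (Sum.elim lam (x + t • v)) p * Complex.exp (lam ⬝ᵥ (x + t • v)))
    = fun t : ℂ => eval (Sum.elim lam (x + t • v)) ((twist (lamForm v) v)^[k] p)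
        * Complex.exp (lam ⬝ᵥ (x + t • v)) := by
  induction k with
  | zero => simp
  | succ k ih =>
    rw [iteratedDeriv_succ, ih, Function.iterate_succ_apply']
    funext t
    exact (hasDerivAt_eval_mul_exp _ lam x v t).deriv

/-- A configuration admits the Baker-Akhiezer function if and only if some polynomial with the
prescribed highest term is quasi-invariant at all hyperplanes. -/
theorem admitsBA_iff (A : Configuration N n) :
    A.AdmitsBA ↔ ∃ P : Poly N, (P - A.highestTerm).totalDegree < 2 * ∑ i, A.mult i ∧
      ∀ i, IsQuasiInvariant (lamForm (A.vec i)) (A.vec i) (A.mult i) P := by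
  have key : ∀ (P : Poly N) (i : Fin (n + 1)),
      (∀ s : ℕ, 1 ≤ s → s ≤ A.mult i → ∀ lam x : Fin N → ℂ, A.vec i ⬝ᵥ x = 0 →
        iteratedDeriv (2 * s - 1) (fun t : ℂ => eval (Sum.elim lam (x + t • A.vec i)) P
          * Complex.exp (lam ⬝ᵥ (x + t • A.vec i))) 0 = 0) ↔
      IsQuasiInvariant (lamForm (A.vec i)) (A.vec i) (A.mult i) P := by
    intro P i
    simp only [iteratedDeriv_eval_mul_exp, mul_eq_zero, Complex.exp_ne_zero, or_false, zero_smul,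
      add_zero, IsQuasiInvariant, xForm_dvd_iff_eval (A.nonisotropic i)]
    constructor
    · intro h s hs
      simpa [show 2 * (s + 1) - 1 = 2 * s + 1 by omega] using h (s + 1) (by omega) (by omega)
    · intro h s hs1 hs2
      simpa [show 2 * (s - 1) + 1 = 2 * s - 1 by omega] using h (s - 1) (by omega)
  constructor
  · rintro ⟨φ, ⟨P, hP, hφ⟩, hq⟩
    refine ⟨P, hP, fun i => (key P i).mp ?_⟩
    simpa only [hφ] using hq i
  · rintro ⟨P, hP, hq⟩
    exact ⟨fun lam x => eval (Sum.elim lam x) P * Complex.exp (lam ⬝ᵥ x),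
      ⟨P, hP, fun _ _ => rfl⟩, fun i => (key P i).mpr (hq i)⟩

/-! ### The equilibrium equations are necessary -/

/-- The vector `v` rotated by a right angle. -/
def rot (v : Fin 2 → ℂ) : Fin 2 → ℂ := ![-v 1, v 0]

theorem rot_dotProduct_self (v : Fin 2 → ℂ) : rot v ⬝ᵥ v = 0 := by
  simp [rot, dotProduct, Fin.sum_univ_two]; ring

theorem rot_dotProduct_ne_zero_iff (v w : Fin 2 → ℂ) :
    rot v ⬝ᵥ w ≠ 0 ↔ LinearIndependent ℂ ![v, w] := by
  have h := Matrix.linearIndependent_rows_iff_isUnit (A := Matrix.of ![v, w])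
  rw [Matrix.isUnit_iff_isUnit_det, isUnit_iff_ne_zero, Matrix.det_fin_two] at h
  have h2 : (Matrix.of ![v, w]).row = ![v, w] := rfl
  rw [h2] at h
  rw [h]
  simp [rot, dotProduct, Fin.sum_univ_two]
  constructor <;> intro h1 h2 <;> apply h1 <;> linear_combination h2

/-- The specialisation `lam = τ w`, where the variable `X (Sum.inl 0)` serves as `τ`. It keeps the
total degree. -/
noncomputable def lamSpecialise (w : Fin 2 → ℂ) : Poly 2 →ₐ[ℂ] Poly 2 :=
  aeval (Sum.elim (fun k => C (w k) * X (Sum.inl 0)) (fun k => X (Sum.inr k)))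

theorem lamSpecialise_xForm (w v : Fin 2 → ℂ) : lamSpecialise w (xForm v) = xForm v := by
  simp [lamSpecialise, xForm, algebraMap_eq]

theorem lamSpecialise_lamForm (w v : Fin 2 → ℂ) :
    lamSpecialise w (lamForm v) = C (w ⬝ᵥ v) * X (Sum.inl 0) := by
  simp [lamSpecialise, lamForm, dotProduct, algebraMap_eq]; ring

theorem lamSpecialise_xDeriv (w v : Fin 2 → ℂ) (p : Poly 2) :
    lamSpecialise w (xDeriv v p) = xDeriv v (lamSpecialise w p) := by
  induction p using MvPolynomial.induction_on with
  | C c => simp [lamSpecialise]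
  | add p q hp hq => simp [hp, hq]
  | mul_X p i hp =>
    have hX : lamSpecialise w (xDeriv v (X i)) = xDeriv v (lamSpecialise w (X i)) := by
      rcases i with k | k
      · simp [lamSpecialise, xDeriv_X_inl]
      · simp [lamSpecialise, xDeriv_X_inr, algebraMap_eq]
    rw [xDeriv_mul, map_add, map_mul, map_mul, hp, hX, map_mul, xDeriv_mul]

theorem lamSpecialise_iterate_twist (w v : Fin 2 → ℂ) (l : Poly 2) (k : ℕ) (p : Poly 2) :
    lamSpecialise w ((twist l v)^[k] p)
      = (twist (lamSpecialise w l) v)^[k] (lamSpecialise w p) := by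
  induction k with
  | zero => rfl
  | succ k ih =>
    rw [Function.iterate_succ_apply', Function.iterate_succ_apply', ← ih, twist_apply, twist_apply,
      map_add, map_mul, lamSpecialise_xDeriv]

theorem lamSpecialise_homogeneousComponent (w : Fin 2 → ℂ) (d : ℕ) (p : Poly 2) :
    homogeneousComponent d (lamSpecialise w p) = lamSpecialise w (homogeneousComponent d p) := by
  refine homogeneousComponent_map_eq (lamSpecialise w).toLinearMap (fun j q hq => ?_) p
  have h : (lamSpecialise w q).IsHomogeneous j := by
    have := hq.aeval (n := 1)
      (Sum.elim (fun k => C (w k) * X (Sum.inl 0)) (fun k => X (Sum.inr k)) :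
        Fin 2 ⊕ Fin 2 → Poly 2) (by
        rintro (k | k)
        · exact isHomogeneous_C_mul_X _ _
        · exact isHomogeneous_X _ _)
    rw [one_mul] at this
    exact this
  change homogeneousComponent d (lamSpecialise w q) = if j = d then lamSpecialise w q else 0
  rw [homogeneousComponent_of_mem h]
  simp [eq_comm]

theorem IsQuasiInvariant.lamSpecialise {l : Poly 2} {a : Fin 2 → ℂ} {m : ℕ} {p : Poly 2}
    (hp : IsQuasiInvariant l a m p) (w : Fin 2 → ℂ) :
    IsQuasiInvariant (lamSpecialise w l) a m (lamSpecialise w p) := by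
  intro s hs
  have := map_dvd (BakerAkhiezer.lamSpecialise w) (hp s hs)
  rwa [lamSpecialise_xForm, lamSpecialise_iterate_twist] at this

/-- Logarithmic differentiation of a product of powers of linear forms, at a point where no factor
vanishes. -/
theorem eval_xDeriv_prod {ι : Type*} (s : Finset ι) (a : ι → Fin N → ℂ) (m : ι → ℕ)
    (v lam x : Fin N → ℂ) (h : ∀ j ∈ s, a j ⬝ᵥ x ≠ 0) :
    eval (Sum.elim lam x) (xDeriv v (∏ j ∈ s, xForm (a j) ^ m j))
      = (∏ j ∈ s, (a j ⬝ᵥ x) ^ m j) * ∑ j ∈ s, m j * (v ⬝ᵥ a j) / (a j ⬝ᵥ x) := by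
  classical
  induction s using Finset.induction_on with
  | empty => simp
  | insert j s hj ih =>
    have hs := ih fun k hk => h k (Finset.mem_insert_of_mem hk)
    have hj0 := h j (Finset.mem_insert_self _ _)
    rw [Finset.prod_insert hj, Finset.prod_insert hj, Finset.sum_insert hj, xDeriv_mul, map_add,
      map_mul, map_mul, hs, Derivation.leibniz_pow, xDeriv_xForm]
    simp only [map_prod, map_pow, eval_xForm, smul_eq_mul, nsmul_eq_mul, map_mul,
      map_natCast, eval_C]
    rcases Nat.eq_zero_or_pos (m j) with h0 | h0
    · simp [h0]
    · obtain ⟨r, hr⟩ : ∃ r, m j = r + 1 := ⟨m j - 1, by omega⟩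
      rw [hr, Nat.add_sub_cancel]
      field_simp
      ring


theorem highestTerm_eq (A : Configuration N n) :
    A.highestTerm = ∏ j, (lamForm (A.vec j) ^ A.mult j * xForm (A.vec j) ^ A.mult j) := rfl

theorem highestTerm_isHomogeneous (A : Configuration N n) :
    A.highestTerm.IsHomogeneous (2 * ∑ i, A.mult i) := by
  rw [highestTerm_eq, Finset.mul_sum]
  refine IsHomogeneous.prod _ _ _ fun j _ => ?_
  have := ((lamForm_isHomogeneous (A.vec j)).pow (A.mult j)).mul
    ((xForm_isHomogeneous (A.vec j)).pow (A.mult j))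
  rwa [one_mul, ← two_mul] at this

theorem not_xForm_dvd_xForm {a b : Fin 2 → ℂ} (ha : a ⬝ᵥ a ≠ 0)
    (hab : LinearIndependent ℂ ![a, b]) : ¬ xForm a ∣ xForm b := by
  rw [xForm_dvd_iff_eval ha]
  intro h
  have := h 0 (rot a) (by rw [dotProduct_comm, rot_dotProduct_self])
  rw [eval_xForm, dotProduct_comm] at this
  exact (rot_dotProduct_ne_zero_iff a b).mpr hab this

/-- Equilibrium of the vector `α_i` in the field of the other vectors: the sum over `j ≠ i` of
`m_j (α_i, α_j) / (rot α_i, α_j)` is zero. For `α_j = (cos φ_j, sin φ_j)` the summand is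
`m_j cot (φ_j - φ_i)`. -/
def IsEquilibrium (A : Configuration 2 n) (i : Fin (n + 1)) : Prop :=
  ∑ j ∈ Finset.univ.erase i,
    (A.mult j : ℂ) * (A.vec i ⬝ᵥ A.vec j) / (rot (A.vec i) ⬝ᵥ A.vec j) = 0

/-- A vector of multiplicity one is in equilibrium. Specialising `lam` to multiples of
`rot (α_i)`, which kills the highest term, makes the component `f` of degree `2 ∑ m_j - 2` a
highest term. It is divisible by the powers of all the other linear forms; the quotient is a
non-zero constant on the line `(α_i, x) = 0`, and the normal derivative of `f` vanishes there. -/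
theorem isEquilibrium_of_admitsBA (A : Configuration 2 n) (hA : A.AdmitsBA) (i : Fin (n + 1))
    (hi : A.mult i = 1) : IsEquilibrium A i := by
  classical
  rcases (Finset.univ.erase i).eq_empty_or_nonempty with he | ⟨j₀, hj₀⟩
  · rw [IsEquilibrium, he, Finset.sum_empty]
  obtain ⟨P, hP, hQ⟩ := (admitsBA_iff A).mp hA
  set a := A.vec with ha
  set m := A.mult with hm
  set w := rot (a i) with hw
  have hai : a i ⬝ᵥ a i ≠ 0 := A.nonisotropic i
  have hwi : w ⬝ᵥ a i = 0 := rot_dotProduct_self _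
  have hwj : ∀ j ∈ Finset.univ.erase i, w ⬝ᵥ a j ≠ 0 := fun j hj =>
    (rot_dotProduct_ne_zero_iff _ _).mpr (A.noncollinear i j (Finset.ne_of_mem_erase hj).symm)
  -- there is a second vector `α_{j₀}`, and so the sum of the multiplicities is at least two
  obtain ⟨M, hM⟩ : ∃ M, ∑ j, m j = M + 2 := by
    refine ⟨∑ j, m j - 2, ?_⟩
    have h1 := Finset.add_sum_erase Finset.univ m (Finset.mem_univ i)
    have h2 := Finset.single_le_sum (f := m) (fun j _ => Nat.zero_le _) hj₀
    have h3 := A.mult_pos j₀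
    have h4 : 1 ≤ m j₀ := h3
    omega
  rw [hM] at hP
  have hH := highestTerm_isHomogeneous A
  change A.highestTerm.IsHomogeneous (2 * ∑ j, m j) at hH
  rw [hM] at hH
  -- the components of `P` of degree at least `2 (M + 2)`
  have hcomp : ∀ d, 2 * (M + 2) ≤ d →
      homogeneousComponent d P = homogeneousComponent d A.highestTerm := by
    intro d hd
    rw [← sub_eq_zero, ← map_sub]
    exact homogeneousComponent_eq_zero _ _ (by omega)
  set δ : Poly 2 := ∏ j ∈ Finset.univ.erase i, xForm (a j) ^ m j with hδ
  set Δ : Poly 2 := ∏ j ∈ Finset.univ.erase i, lamForm (a j) ^ m j with hΔ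
  have hHi : A.highestTerm = lamForm (a i) * (xForm (a i) * (Δ * δ)) := by
    rw [highestTerm_eq, ← Finset.mul_prod_erase Finset.univ _ (Finset.mem_univ i),
      Finset.prod_mul_distrib]
    change lamForm (a i) ^ m i * xForm (a i) ^ m i * (Δ * δ) = _
    rw [hi]; ring
  have hSi : lamSpecialise w (lamForm (a i)) = 0 := by
    rw [lamSpecialise_lamForm, hwi, C_0, zero_mul]
  set f := homogeneousComponent (2 * M + 2) (lamSpecialise w P) with hf
  have hfP : f = lamSpecialise w (homogeneousComponent (2 * M + 2) P) :=
    lamSpecialise_homogeneousComponent _ _ _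
  have hzero : ∀ k, homogeneousComponent (2 * M + 2 + 2 * (k + 1)) (lamSpecialise w P) = 0 := by
    intro k
    rw [lamSpecialise_homogeneousComponent, hcomp _ (by omega),
      ← lamSpecialise_homogeneousComponent, hHi, map_mul, hSi, zero_mul, map_zero]
  have hdvd : ∀ j ∈ Finset.univ.erase i, xForm (a j) ^ m j ∣ f := by
    intro j hj
    have hq := (hQ j).lamSpecialise w
    rw [lamSpecialise_lamForm] at hq
    refine hq.pow_dvd_homogeneousComponent (isHomogeneous_C_mul_X _ _) (A.nonisotropic j) ?_ _ _
      hzero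
    rw [xForm_dvd_C_mul_iff (hwj j hj), ← hyperRestrict_eq_zero_iff (A.nonisotropic j),
      hyperRestrict_X_inl]
    exact X_ne_zero _
  obtain ⟨g, hg⟩ : δ ∣ f := by
    refine Finset.prod_dvd_of_isRelPrime (fun j _ k _ hjk => ?_) hdvd
    refine IsRelPrime.pow
      ((xForm_prime (A.nonisotropic j)).irreducible.isRelPrime_iff_not_dvd.mpr ?_)
    exact not_xForm_dvd_xForm (A.nonisotropic j) (A.noncollinear j k hjk)
  have hndvd : ¬ xForm (a i) ∣ δ := by
    rw [hδ, (xForm_prime hai).dvd_finsetProd_iff]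
    rintro ⟨j, hj, h⟩
    exact not_xForm_dvd_xForm hai (A.noncollinear i j (Finset.ne_of_mem_erase hj).symm)
      ((xForm_prime hai).dvd_of_dvd_pow h)
  have hQi : xForm (a i) ∣ twist (lamForm (a i)) (a i) P := hQ i 0 (by omega)
  -- the quotient is constant on the line `(α_i, x) = 0`
  have hgline : xForm (a i) ∣ C (a i ⬝ᵥ a i) * lamSpecialise w Δ + g := by
    have h1 := xForm_dvd_homogeneousComponent hQi (2 * M + 2)
    rw [homogeneousComponent_twist (lamForm_isHomogeneous _), hcomp _ (by omega),
      show 2 * M + 2 + 2 = 2 * (M + 2) by ring, homogeneousComponent_eq_self hH, hHi,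
      xDeriv_mul, xDeriv_lamForm, zero_mul, zero_add,
      ← mul_add, xDeriv_mul, xDeriv_xForm] at h1
    have h2 := ((xForm_prime hai).dvd_or_dvd h1).resolve_left (by
      rw [← hyperRestrict_eq_zero_iff hai, hyperRestrict_lamForm]
      intro h0
      have h3 := eval_lamForm (a i) (a i) 0
      rw [h0, map_zero] at h3
      exact hai h3.symm)
    rw [add_right_comm, dvd_add_left (dvd_mul_right _ _)] at h2
    have h3 := map_dvd (lamSpecialise w) h2
    have hδs : lamSpecialise w δ = δ := by
      simp only [hδ, map_prod, map_pow, lamSpecialise_xForm]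
    have hCs : ∀ c : ℂ, lamSpecialise w (C c) = C c := fun c => by
      simp [lamSpecialise, algebraMap_eq]
    rw [lamSpecialise_xForm, map_add, ← hfP, hg, map_mul, map_mul, hδs, hCs] at h3
    refine ((xForm_prime hai).dvd_or_dvd (?_ : xForm (a i) ∣ δ * _)).resolve_left hndvd
    convert h3 using 1; ring
  -- the normal derivative of `f` vanishes on the line
  have hderiv : xForm (a i) ∣ xDeriv (a i) δ * g + δ * xDeriv (a i) g := by
    rw [← xDeriv_mul, ← hg]
    have h1 := map_dvd (lamSpecialise w) hQi
    have h2 := lamSpecialise_iterate_twist w (a i) (lamForm (a i)) 1 P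
    rw [Function.iterate_one, Function.iterate_one, hSi] at h2
    rw [lamSpecialise_xForm, h2] at h1
    have h3 := xForm_dvd_homogeneousComponent h1 (2 * M)
    rwa [homogeneousComponent_twist (isHomogeneous_zero _ _ _), zero_mul, add_zero] at h3
  have hline : ∀ y : ℂ, a i ⬝ᵥ (y • w) = 0 := fun y => by
    rw [dotProduct_smul, dotProduct_comm, hwi, smul_zero]
  set c₀ : ℂ := (a i ⬝ᵥ a i) * eval (Sum.elim 1 0) (lamSpecialise w Δ) with hc₀
  have hΔs : ∀ x : Fin 2 → ℂ, eval (Sum.elim 1 x) (lamSpecialise w Δ)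
      = ∏ j ∈ Finset.univ.erase i, (w ⬝ᵥ a j) ^ m j := by
    intro x
    simp [hΔ, lamSpecialise_lamForm]
  have hc₀0 : c₀ ≠ 0 := by
    rw [hc₀, hΔs]
    exact mul_ne_zero hai (Finset.prod_ne_zero_iff.mpr fun j hj => pow_ne_zero _ (hwj j hj))
  have hgval : ∀ y : ℂ, eval (Sum.elim 1 (y • w)) g = -c₀ := by
    intro y
    have := (xForm_dvd_iff_eval hai).mp hgline 1 (y • w) (hline y)
    rw [map_add, map_mul, eval_C, hΔs] at this
    rw [hc₀, hΔs]
    linear_combination this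
  set S := ∑ j ∈ Finset.univ.erase i, (m j : ℂ) * (a i ⬝ᵥ a j) / (w ⬝ᵥ a j) with hS
  have hoff : ∀ y : ℂ, y ≠ 0 →
      S * c₀ = y * eval (Sum.elim 1 (y • w)) (xDeriv (a i) g) := by
    intro y hy
    have hne : ∀ j ∈ Finset.univ.erase i, a j ⬝ᵥ (y • w) ≠ 0 := fun j hj => by
      rw [dotProduct_smul, dotProduct_comm]
      exact mul_ne_zero hy (hwj j hj)
    have h1 := (xForm_dvd_iff_eval hai).mp hderiv 1 (y • w) (hline y)
    rw [map_add, map_mul, map_mul, eval_xDeriv_prod _ _ _ _ _ _ hne, hgval] at h1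
    have h2 : eval (Sum.elim 1 (y • w)) δ
        = ∏ j ∈ Finset.univ.erase i, (a j ⬝ᵥ (y • w)) ^ m j := by
      simp [hδ, eval_xForm]
    have h3 : ∑ j ∈ Finset.univ.erase i, (m j : ℂ) * (a i ⬝ᵥ a j) / (a j ⬝ᵥ (y • w)) = S / y := by
      rw [hS, Finset.sum_div]
      refine Finset.sum_congr rfl fun j _ => ?_
      rw [dotProduct_smul, dotProduct_comm (a j) w, smul_eq_mul, div_div, mul_comm y]
    rw [h2, h3, mul_assoc, ← mul_add] at h1
    have h4 := (mul_eq_zero.mp h1).resolve_left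
      (Finset.prod_ne_zero_iff.mpr fun j hj => pow_ne_zero _ (hne j hj))
    field_simp at h4
    linear_combination -h4
  -- both sides are continuous in `y`, so that the identity holds at `y = 0` too
  have hcont : Continuous fun y : ℂ => y * eval (Sum.elim 1 (y • w)) (xDeriv (a i) g) := by
    refine continuous_id.mul ?_
    refine (MvPolynomial.continuous_eval _).comp ?_
    refine continuous_pi fun k => ?_
    rcases k with k | k
    · exact continuous_const
    · exact continuous_id.mul continuous_const
  have hall := Continuous.ext_on (dense_compl_singleton (0 : ℂ))
    (continuous_const (y := S * c₀)) hcont (fun y hy => hoff y hy)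
  have h0 := congrFun hall 0
  simp only [zero_mul, mul_eq_zero, hc₀0, or_false] at h0
  exact h0

end BakerAkhiezer

/-! ### The Calogero-Moser operator on quasi-invariants -/

namespace BakerAkhiezer

open MvPolynomial

variable {N n : ℕ}

/-- The conjugate of the operator `∑ ∂²/∂x_k² - ∑ 2 m_j / (α_j, x) (α_j, ∂/∂x) - (lam, lam)` by
multiplication with `exp (lam, x)`, applied to `p`, where `q j` stands for the quotient of
`twist (α_j, lam) α_j p` by `(α_j, x)`. -/
noncomputable def calogeroStep (A : Configuration N n) (p : Poly N) (q : Fin (n + 1) → Poly N) :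
    Poly N :=
  ∑ k, twist (lamForm (Pi.single k 1)) (Pi.single k 1)
      (twist (lamForm (Pi.single k 1)) (Pi.single k 1) p)
    - (∑ k, X (Sum.inl k) ^ 2) * p - 2 * ∑ j, C (A.mult j : ℂ) * q j

/-- The derivation `(lam, ∂/∂x)`. -/
noncomputable def lamDeriv : Derivation ℂ (Poly N) (Poly N) :=
  mkDerivation ℂ (Sum.elim (fun _ => 0) (fun k => X (Sum.inl k)))

theorem lamDeriv_mul (p q : Poly N) :
    lamDeriv (p * q) = lamDeriv p * q + p * lamDeriv q := by
  rw [Derivation.leibniz, smul_eq_mul, smul_eq_mul]; ring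

theorem lamForm_single (k : Fin N) : lamForm (Pi.single k 1) = X (Sum.inl k) := by
  classical
  simp [lamForm, Pi.single_apply]

theorem lamDeriv_xForm (v : Fin N → ℂ) : lamDeriv (xForm v) = lamForm v := by
  simp [xForm, lamForm, lamDeriv]

theorem lamDeriv_lamForm (v : Fin N → ℂ) : lamDeriv (lamForm v) = 0 := by
  simp [lamForm, lamDeriv]

theorem lamDeriv_eq_sum (p : Poly N) :
    lamDeriv p = ∑ k, X (Sum.inl k) * xDeriv (Pi.single k 1) p := by
  classical
  induction p using MvPolynomial.induction_on with
  | C c => simp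
  | add p q hp hq => simp only [map_add, hp, hq, mul_add, Finset.sum_add_distrib]
  | mul_X p i hp =>
    rw [lamDeriv_mul, hp]
    simp only [xDeriv_mul, mul_add, Finset.sum_add_distrib, Finset.sum_mul]
    congr 1
    · exact Finset.sum_congr rfl fun k _ => by ring
    · rcases i with k | k
      · simp [xDeriv_X_inl, lamDeriv]
      · simp [xDeriv_X_inr, lamDeriv, Pi.single_apply, mul_comm]

theorem calogeroStep_eq (A : Configuration N n) (p : Poly N) (q : Fin (n + 1) → Poly N) :
    calogeroStep A p q = ∑ k : Fin N, xDeriv (Pi.single k 1) (xDeriv (Pi.single k 1) p)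
      + 2 * lamDeriv p - 2 * ∑ j, C (A.mult j : ℂ) * q j := by
  rw [calogeroStep, lamDeriv_eq_sum]
  congr 1
  rw [Finset.sum_mul, Finset.mul_sum, ← Finset.sum_sub_distrib, ← Finset.sum_add_distrib]
  refine Finset.sum_congr rfl fun k _ => ?_
  simp only [twist_apply, map_add, xDeriv_mul, lamForm_single, xDeriv_X_inl]
  ring

theorem totalDegree_xDeriv_le (v : Fin N → ℂ) {p : Poly N} {d : ℕ} (hp : p.totalDegree ≤ d) :
    (xDeriv v p).totalDegree ≤ d - 1 := by
  rw [← sum_homogeneousComponent p, map_sum]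
  refine (totalDegree_finsetSum _ _).trans (Finset.sup_le fun j hj => ?_)
  refine ((isHomogeneous_xDeriv v (homogeneousComponent_isHomogeneous j p)).totalDegree_le).trans ?_
  have := Finset.mem_range.mp hj
  omega

theorem totalDegree_lamForm_mul_le (v : Fin N → ℂ) {p : Poly N} {d : ℕ} (hp : p.totalDegree ≤ d) :
    (lamForm v * p).totalDegree ≤ d + 1 := by
  refine (totalDegree_mul _ _).trans ?_
  have := (lamForm_isHomogeneous v).totalDegree_le
  omega

theorem totalDegree_lamDeriv_le {p : Poly N} {d : ℕ} (hp : p.totalDegree ≤ d) :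
    (lamDeriv p).totalDegree ≤ d := by
  rcases Nat.eq_zero_or_pos p.totalDegree with h0 | h0
  · rw [totalDegree_eq_zero_iff_eq_C] at h0
    rw [h0]
    simp
  · rw [lamDeriv_eq_sum]
    refine totalDegree_finsetSum_le fun k _ => ?_
    rw [← lamForm_single]
    have := totalDegree_lamForm_mul_le (Pi.single k 1) (totalDegree_xDeriv_le (Pi.single k 1) hp)
    omega

theorem totalDegree_le_of_xForm_mul {v : Fin N → ℂ} (hv : v ≠ 0) {p : Poly N} {d : ℕ}
    (hp : (xForm v * p).totalDegree ≤ d + 1) : p.totalDegree ≤ d := by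
  rcases eq_or_ne p 0 with rfl | h0
  · simp
  · rw [totalDegree_mul_of_isDomain (xForm_ne_zero hv) h0,
      (xForm_isHomogeneous v).totalDegree (xForm_ne_zero hv)] at hp
    omega

theorem derivation_prod_pow {ι : Type*} [DecidableEq ι] (D : Derivation ℂ (Poly N) (Poly N))
    (s : Finset ι) (f : ι → Poly N) (m : ι → ℕ) :
    D (∏ j ∈ s, f j ^ m j)
      = ∑ j ∈ s, C (m j : ℂ) * D (f j) * (f j ^ (m j - 1) * ∏ k ∈ s.erase j, f k ^ m k) := by
  induction s using Finset.induction_on with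
  | empty => simp
  | insert i s hi ih =>
    rw [Finset.prod_insert hi, Finset.sum_insert hi, Derivation.leibniz, ih,
      Derivation.leibniz_pow, Finset.erase_insert hi, add_comm]
    congr 1
    · simp only [smul_eq_mul, nsmul_eq_mul, map_natCast]
      ring
    · rw [smul_eq_mul, Finset.mul_sum]
      refine Finset.sum_congr rfl fun j hj => ?_
      have hji : i ≠ j := fun h => hi (h ▸ hj)
      rw [Finset.erase_insert_of_ne hji,
        Finset.prod_insert (fun h => hi (Finset.mem_of_mem_erase h))]
      ring

theorem iterate_lamDeriv_mul {u v : Poly N} (hu : lamDeriv u = v) (hv : lamDeriv v = 0) (k : ℕ)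
    (p : Poly N) :
    lamDeriv^[k + 1] (u * p) = u * lamDeriv^[k + 1] p + C ((k : ℂ) + 1) * v * lamDeriv^[k] p := by
  induction k with
  | zero => simp [hu]; ring
  | succ k ih =>
    rw [Function.iterate_succ_apply', ih, map_add, lamDeriv_mul, lamDeriv_mul, lamDeriv_mul, hu, hv,
      ← Function.iterate_succ_apply' lamDeriv, ← Function.iterate_succ_apply' lamDeriv]
    have : lamDeriv (C ((k : ℂ) + 1) : Poly N) = 0 := by simp [lamDeriv]
    rw [this]
    simp only [Nat.succ_eq_add_one, Nat.cast_add, Nat.cast_one, map_add, C_1]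
    ring

/-- The `k`-th derivative of a product of `k` linear forms in the direction `lam` is `k!` times the
value of the product at `lam`. -/
theorem iterate_lamDeriv_prod {ι : Type*} (s : Finset ι) (a : ι → Fin N → ℂ) (m : ι → ℕ) :
    lamDeriv^[∑ j ∈ s, m j] (∏ j ∈ s, xForm (a j) ^ m j)
      = C ((∑ j ∈ s, m j).factorial : ℂ) * ∏ j ∈ s, lamForm (a j) ^ m j := by
  classical
  have step : ∀ (v : Fin N → ℂ) (k r : ℕ) (F G : Poly N), lamDeriv G = 0 →
      lamDeriv^[k] F = C (k.factorial : ℂ) * G →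
      lamDeriv^[r + k] (xForm v ^ r * F) = C ((r + k).factorial : ℂ) * (lamForm v ^ r * G) := by
    intro v k r F G hG hF
    induction r with
    | zero => simpa using hF
    | succ r ih =>
      have h0 : lamDeriv (lamForm v ^ r * G) = 0 := by
        rw [lamDeriv_mul, hG, Derivation.leibniz_pow, lamDeriv_lamForm]; simp
      have h1 : lamDeriv^[r + k + 1] (xForm v ^ r * F) = 0 := by
        rw [Function.iterate_succ_apply', ih, lamDeriv_mul, h0]
        simp [lamDeriv]
      rw [pow_succ', mul_assoc, show r + 1 + k = r + k + 1 by ring,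
        iterate_lamDeriv_mul (lamDeriv_xForm v) (lamDeriv_lamForm v), h1, ih, Nat.factorial_succ]
      push_cast
      simp only [map_mul, map_add, C_1]
      ring
  have hker : ∀ s : Finset ι, lamDeriv (∏ j ∈ s, lamForm (a j) ^ m j) = 0 := by
    intro s
    rw [derivation_prod_pow]
    exact Finset.sum_eq_zero fun j _ => by rw [lamDeriv_lamForm]; simp
  induction s using Finset.induction_on with
  | empty => simp
  | insert i s hi ih =>
    rw [Finset.prod_insert hi, Finset.prod_insert hi, Finset.sum_insert hi]
    exact step _ _ _ _ _ (hker s) ih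

theorem pow_dvd_twist {l : Poly N} {a : Fin N → ℂ} {p : Poly N} (k : ℕ)
    (h : xForm a ^ (k + 1) ∣ p) : xForm a ^ k ∣ twist l a p := by
  induction k generalizing p with
  | zero => simp
  | succ k ih =>
    obtain ⟨q, rfl⟩ := h
    rw [pow_succ' _ (k + 1), mul_assoc, twist_xForm_mul]
    refine dvd_add ((dvd_mul_right _ _).mul_left _) ?_
    have h1 := mul_dvd_mul_left (xForm a) (ih (p := xForm a ^ (k + 1) * q) ⟨q, rfl⟩)
    rwa [← pow_succ'] at h1

theorem pow_dvd_iterate_twist {l : Poly N} {a : Fin N → ℂ} {p : Poly N} (j k : ℕ)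
    (h : xForm a ^ (k + j) ∣ p) : xForm a ^ k ∣ (twist l a)^[j] p := by
  induction j generalizing k with
  | zero => exact h
  | succ j ih =>
    rw [Function.iterate_succ_apply']
    exact pow_dvd_twist k (ih (k + 1) (by rwa [add_assoc, add_comm 1 j]))

theorem isQuasiInvariant_of_pow_dvd {l : Poly N} {a : Fin N → ℂ} {p : Poly N} {m : ℕ}
    (h : xForm a ^ (2 * m) ∣ p) : IsQuasiInvariant l a m p := by
  intro s hs
  obtain ⟨k, hk⟩ : ∃ k, 2 * m = (k + 1) + (2 * s + 1) := ⟨2 * m - (2 * s + 2), by omega⟩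
  rw [hk] at h
  exact (dvd_pow_self _ k.succ_ne_zero).trans (pow_dvd_iterate_twist _ _ h)

theorem IsQuasiInvariant.C_mul {l : Poly N} {a : Fin N → ℂ} {p : Poly N} {m : ℕ}
    (h : IsQuasiInvariant l a m p) (c : ℂ) : IsQuasiInvariant l a m (C c * p) := by
  intro s hs
  rw [iterate_twist_smul]
  exact (h s hs).mul_left _

theorem IsQuasiInvariant.add {l : Poly N} {a : Fin N → ℂ} {p q : Poly N} {m : ℕ}
    (hp : IsQuasiInvariant l a m p) (hq : IsQuasiInvariant l a m q) :
    IsQuasiInvariant l a m (p + q) := by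
  intro s hs
  rw [iterate_twist_add]
  exact dvd_add (hp s hs) (hq s hs)

/-- If the Calogero-Moser operator preserves quasi-invariance, then its power of exponent
`M = ∑ m_j`, applied to `∏ (α_j, x)^{2 m_j}`, is `2^M M!` times a polynomial that satisfies the
Baker-Akhiezer conditions. Modulo terms of lower total degree, one application of the operator turns
`δ g` with `δ = ∏ (α_j, x)^{m_j}` into `2 δ (lam, ∂/∂x) g`. -/
theorem admitsBA_of_calogeroStep (A : Configuration N n)
    (hA : ∀ (p : Poly N) (q : Fin (n + 1) → Poly N),
      (∀ i, IsQuasiInvariant (lamForm (A.vec i)) (A.vec i) (A.mult i) p) →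
      (∀ j, xForm (A.vec j) * q j = twist (lamForm (A.vec j)) (A.vec j) p) →
      ∀ i, IsQuasiInvariant (lamForm (A.vec i)) (A.vec i) (A.mult i) (calogeroStep A p q)) :
    A.AdmitsBA := by
  classical
  obtain ⟨D, hD⟩ : ∃ D, 2 * ∑ j, A.mult j = D + 2 := by
    have h1 := Finset.single_le_sum (f := A.mult) (fun j _ => Nat.zero_le _)
      (Finset.mem_univ (0 : Fin (n + 1)))
    have h2 := A.mult_pos 0
    exact ⟨2 * ∑ j, A.mult j - 2, by omega⟩
  set M := ∑ j, A.mult j with hM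
  set δ : Poly N := ∏ j, xForm (A.vec j) ^ A.mult j with hδ
  have hδdeg : δ.totalDegree ≤ M := by
    have := IsHomogeneous.prod Finset.univ (fun j => xForm (A.vec j) ^ A.mult j) A.mult
      (fun j _ => by simpa using (xForm_isHomogeneous (A.vec j)).pow (A.mult j))
    exact this.totalDegree_le
  have hgdeg : ∀ k, (lamDeriv^[k] δ).totalDegree ≤ M := by
    intro k
    induction k with
    | zero => exact hδdeg
    | succ k ih =>
      rw [Function.iterate_succ_apply']
      exact totalDegree_lamDeriv_le ih
  have hδg : ∀ k (c : ℂ), (C c * (δ * lamDeriv^[k] δ)).totalDegree ≤ D + 2 := by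
    intro k c
    refine (totalDegree_mul _ _).trans ?_
    have h1 := totalDegree_mul δ (lamDeriv^[k] δ)
    have h2 := hgdeg k
    rw [totalDegree_C]
    omega
  set δ' : Fin (n + 1) → Poly N := fun j => xForm (A.vec j) ^ (A.mult j - 1)
    * ∏ k ∈ Finset.univ.erase j, xForm (A.vec k) ^ A.mult k with hδ'
  have hxδ' : ∀ j, xForm (A.vec j) * δ' j = δ := by
    intro j
    have := A.mult_pos j
    rw [hδ', hδ, ← Finset.mul_prod_erase Finset.univ _ (Finset.mem_univ j), ← mul_assoc,
      ← pow_succ', Nat.sub_add_cancel this]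
  have hLδ : lamDeriv δ = ∑ j, C (A.mult j : ℂ) * (lamForm (A.vec j) * δ' j) := by
    rw [hδ, derivation_prod_pow]
    exact Finset.sum_congr rfl fun j _ => by rw [lamDeriv_xForm, mul_assoc]
  -- `p` is the result of `k` applications of the operator to `δ ^ 2`, and `r` its lower terms
  have main : ∀ k : ℕ, ∃ p r : Poly N,
      (∀ i, IsQuasiInvariant (lamForm (A.vec i)) (A.vec i) (A.mult i) p) ∧
      p = C (2 ^ k : ℂ) * (δ * lamDeriv^[k] δ) + r ∧ r.totalDegree ≤ D + 1 := by
    intro k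
    induction k with
    | zero =>
      refine ⟨δ * δ, 0, fun i => isQuasiInvariant_of_pow_dvd ?_, by simp, by simp⟩
      rw [two_mul, pow_add]
      have : xForm (A.vec i) ^ A.mult i ∣ δ :=
        Finset.dvd_prod_of_mem (fun j => xForm (A.vec j) ^ A.mult j) (Finset.mem_univ i)
      exact mul_dvd_mul this this
    | succ k ih =>
      obtain ⟨p, r, hp, hpr, hr⟩ := ih
      have hpdeg : p.totalDegree ≤ D + 2 := by
        rw [hpr]
        exact (totalDegree_add _ _).trans (max_le (hδg _ _) (by omega))
      have hex : ∀ j, ∃ q, xForm (A.vec j) * q = twist (lamForm (A.vec j)) (A.vec j) p := by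
        intro j
        obtain ⟨q, hq⟩ := hp j 0 (A.mult_pos j)
        exact ⟨q, hq.symm⟩
      choose q hq using hex
      set s : Fin (n + 1) → Poly N := fun j =>
        q j - C (2 ^ k : ℂ) * (lamForm (A.vec j) * δ' j * lamDeriv^[k] δ) with hs
      have hsdeg : ∀ j, (s j).totalDegree ≤ D + 1 := by
        intro j
        apply totalDegree_le_of_xForm_mul (ne_zero_of_nonisotropic (A.nonisotropic j))
        have : xForm (A.vec j) * s j = xDeriv (A.vec j) p + lamForm (A.vec j) * r := by
          have h1 := hq j
          rw [twist_apply] at h1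
          have h2 := hxδ' j
          simp only [hs]
          linear_combination h1 + lamForm (A.vec j) * hpr
            - C (2 ^ k : ℂ) * lamForm (A.vec j) * lamDeriv^[k] δ * h2
        rw [this]
        refine (totalDegree_add _ _).trans (max_le ?_ (totalDegree_lamForm_mul_le _ hr))
        exact (totalDegree_xDeriv_le _ hpdeg).trans (by omega)
      refine ⟨calogeroStep A p q,
        ∑ k : Fin N, xDeriv (Pi.single k 1) (xDeriv (Pi.single k 1) p) + C 2 * lamDeriv r
          - C 2 * ∑ j, C (A.mult j : ℂ) * s j, hA p q hp hq, ?_, ?_⟩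
      · have hsum : ∑ j, C (A.mult j : ℂ) * q j
            = C (2 ^ k : ℂ) * (lamDeriv δ * lamDeriv^[k] δ) + ∑ j, C (A.mult j : ℂ) * s j := by
          rw [hLδ, Finset.sum_mul, Finset.mul_sum, ← Finset.sum_add_distrib]
          refine Finset.sum_congr rfl fun j _ => ?_
          simp only [hs]
          ring
        have hL : lamDeriv p = C (2 ^ k : ℂ) * (lamDeriv δ * lamDeriv^[k] δ
            + δ * lamDeriv^[k + 1] δ) + lamDeriv r := by
          have h0 : lamDeriv (C (2 ^ k : ℂ) : Poly N) = 0 := by simp [lamDeriv]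
          rw [hpr, map_add, lamDeriv_mul, lamDeriv_mul, Function.iterate_succ_apply', h0, zero_mul,
            zero_add]
        have h2 : (C (2 : ℂ) : Poly N) = 2 := map_ofNat C 2
        rw [calogeroStep_eq, hsum, hL, pow_succ, C_mul, h2]
        ring
      · have hCdeg : ∀ (c : ℂ) (f : Poly N), f.totalDegree ≤ D + 1 →
            (C c * f).totalDegree ≤ D + 1 := by
          intro c f hf
          refine (totalDegree_mul _ _).trans ?_
          rw [totalDegree_C]
          omega
        refine (totalDegree_sub _ _).trans (max_le ((totalDegree_add _ _).trans (max_le ?_ ?_)) ?_)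
        · refine totalDegree_finsetSum_le fun k _ => ?_
          have := totalDegree_xDeriv_le (Pi.single k 1) (totalDegree_xDeriv_le (Pi.single k 1) hpdeg)
          omega
        · exact hCdeg _ _ (totalDegree_lamDeriv_le hr)
        · exact hCdeg _ _ (totalDegree_finsetSum_le fun j _ => hCdeg _ _ (hsdeg j))
  obtain ⟨p, r, hp, hpr, hr⟩ := main M
  rw [admitsBA_iff]
  have hc : ((2 : ℂ) ^ M * (M.factorial : ℂ)) ≠ 0 :=
    mul_ne_zero (pow_ne_zero _ two_ne_zero) (by exact_mod_cast M.factorial_ne_zero)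
  refine ⟨C ((2 : ℂ) ^ M * (M.factorial : ℂ))⁻¹ * p, ?_, fun i => (hp i).C_mul _⟩
  have hH : A.highestTerm = (∏ j, lamForm (A.vec j) ^ A.mult j) * δ := by
    rw [highestTerm_eq, Finset.prod_mul_distrib]
  have : C ((2 : ℂ) ^ M * (M.factorial : ℂ))⁻¹ * p - A.highestTerm
      = C ((2 : ℂ) ^ M * (M.factorial : ℂ))⁻¹ * r := by
    rw [hpr, hδ, hM, iterate_lamDeriv_prod, ← hM, ← hδ, hH]
    have h1 : C ((2 : ℂ) ^ M * (M.factorial : ℂ))⁻¹ * (C ((2 : ℂ) ^ M) * C (M.factorial : ℂ))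
        = (1 : Poly N) := by
      rw [← C_mul, ← C_mul, inv_mul_cancel₀ hc, C_1]
    linear_combination (δ * ∏ j, lamForm (A.vec j) ^ A.mult j) * h1
  rw [this, hD]
  refine lt_of_le_of_lt (totalDegree_mul _ _) ?_
  rw [totalDegree_C]
  omega

end BakerAkhiezer

/-! ### Preservation of quasi-invariance in the plane -/

namespace BakerAkhiezer

open MvPolynomial

theorem IsQuasiInvariant.sum {N : ℕ} {l : Poly N} {a : Fin N → ℂ} {m : ℕ} {ι : Type*}
    (s : Finset ι) {p : ι → Poly N} (hp : ∀ j ∈ s, IsQuasiInvariant l a m (p j)) :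
    IsQuasiInvariant l a m (∑ j ∈ s, p j) := by
  classical
  induction s using Finset.induction_on with
  | empty =>
    intro k _
    rw [Finset.sum_empty, iterate_map_zero]
    exact dvd_zero _
  | insert j s hj ih =>
    rw [Finset.sum_insert hj]
    exact (hp j (Finset.mem_insert_self _ _)).add
      (ih fun k hk => hp k (Finset.mem_insert_of_mem hk))

theorem twist_comb (c d : ℂ) (v w : Fin 2 → ℂ) (p : Poly 2) :
    twist (lamForm (c • v + d • w)) (c • v + d • w) p
      = C c * twist (lamForm v) v p + C d * twist (lamForm w) w p := by
  simp only [twist_apply, lamForm_add, lamForm_smul, xDeriv_add_left, xDeriv_smul_left,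
    Derivation.add_apply, Derivation.smul_apply, MvPolynomial.smul_eq_C_mul]
  ring

theorem xForm_comb (c d : ℂ) (v w : Fin 2 → ℂ) :
    xForm (c • v + d • w) = C c * xForm v + C d * xForm w := by
  rw [xForm_add, xForm_smul, xForm_smul]

/-- Coordinates in the orthonormal frame `u`, `rot u`. -/
theorem eq_frame {u : Fin 2 → ℂ} (hu : u ⬝ᵥ u = 1) (v : Fin 2 → ℂ) :
    v = (u ⬝ᵥ v) • u + (rot u ⬝ᵥ v) • rot u := by
  simp only [dotProduct, Fin.sum_univ_two] at hu
  funext k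
  fin_cases k <;> simp [rot, dotProduct, Fin.sum_univ_two]
  · linear_combination (-v 0) * hu
  · linear_combination (-v 1) * hu

theorem dotProduct_rot_self (u : Fin 2 → ℂ) : u ⬝ᵥ rot u = 0 := by
  rw [dotProduct_comm, rot_dotProduct_self]

theorem laplacian_frame {u : Fin 2 → ℂ} (hu : u ⬝ᵥ u = 1) (p : Poly 2) :
    ∑ k, twist (lamForm (Pi.single k 1)) (Pi.single k 1)
      (twist (lamForm (Pi.single k 1)) (Pi.single k 1) p)
    = twist (lamForm u) u (twist (lamForm u) u p)
      + twist (lamForm (rot u)) (rot u) (twist (lamForm (rot u)) (rot u) p) := by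
  have h0 := eq_frame hu (Pi.single 0 1)
  have h1 := eq_frame hu (Pi.single 1 1)
  simp only [dotProduct_single, mul_one, rot, Matrix.cons_val_zero, Matrix.cons_val_one] at h0 h1
  rw [Fin.sum_univ_two]
  have hC : C (u 0) * C (u 0) + C (u 1) * C (u 1) = (1 : Poly 2) := by
    rw [← C_mul, ← C_mul, ← C_add, ← C_1]
    congr 1
    simpa [dotProduct, Fin.sum_univ_two] using hu
  change Pi.single 0 1 = u 0 • u + (-u 1) • rot u at h0
  change Pi.single 1 1 = u 1 • u + u 0 • rot u at h1
  rw [h0, h1]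
  simp only [twist_comb, map_add, twist_C_mul, twist_comm (rot u) u]
  simp only [C_neg]
  linear_combination (twist (lamForm u) u (twist (lamForm u) u p)
    + twist (lamForm (rot u)) (rot u) (twist (lamForm (rot u)) (rot u) p)) * hC

theorem iterate_twist_lam_mul {N : ℕ} (l : Poly N) (v : Fin N → ℂ) (k : ℕ) (p : Poly N) :
    (twist l v)^[k] ((∑ k, X (Sum.inl k) ^ 2) * p)
      = (∑ k, X (Sum.inl k) ^ 2) * (twist l v)^[k] p := by
  induction k with
  | zero => rfl
  | succ k ih =>
    rw [Function.iterate_succ_apply', ih, Function.iterate_succ_apply', twist_apply, xDeriv_mul,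
      twist_apply]
    have : xDeriv v (∑ k, X (Sum.inl k) ^ 2 : Poly N) = 0 := by
      simp [Derivation.leibniz_pow, xDeriv_X_inl]
    rw [this]; ring

/-- At a line of multiplicity one, equilibrium makes the Calogero-Moser operator preserve
quasi-invariance. -/
theorem isQuasiInvariant_calogeroStep_of_isEquilibrium {n : ℕ} (A : Configuration 2 n)
    (i : Fin (n + 1)) (hi : A.mult i = 1) (hu : A.vec i ⬝ᵥ A.vec i = 1) (hA : IsEquilibrium A i)
    (p : Poly 2) (q : Fin (n + 1) → Poly 2)
    (hq : ∀ j, xForm (A.vec j) * q j = twist (lamForm (A.vec j)) (A.vec j) p) :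
    IsQuasiInvariant (lamForm (A.vec i)) (A.vec i) (A.mult i) (calogeroStep A p q) := by
  classical
  intro s hs
  obtain rfl : s = 0 := by omega
  rw [mul_zero, zero_add, Function.iterate_one]
  set u := A.vec i with hu'
  have hu0 : u ⬝ᵥ u ≠ 0 := A.nonisotropic i
  set w := rot u with hw
  have huw : u ⬝ᵥ w = 0 := dotProduct_rot_self u
  have hwu : w ⬝ᵥ u = 0 := rot_dotProduct_self u
  set Eu := twist (lamForm u) u with hEu
  set Ew := twist (lamForm w) w with hEw
  set π := hyperRestrict u with hπ
  have hπu : π (xForm u) = 0 := hyperRestrict_self hu0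
  have hπw : π (xForm w) = xForm w := by
    rw [hπ, hyperRestrict_xForm, huw]; simp
  have hw0 : xForm w ≠ 0 := by
    apply xForm_ne_zero
    intro h
    have h2 : w ⬝ᵥ w = 1 := by
      rw [← hu]; simp [hw, rot, dotProduct, Fin.sum_univ_two]; ring
    rw [h] at h2
    simp at h2
  have hqi : Eu p = xForm u * q i := (hq i).symm
  have hEuu : ∀ f, Eu (xForm u * f) = f + xForm u * Eu f := fun f => by
    rw [hEu, twist_xForm_mul, hu, C_1, one_mul]
  have hEwu : ∀ f, Ew (xForm u * f) = xForm u * Ew f := fun f => by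
    rw [hEw, twist_xForm_mul, hwu, C_0, zero_mul, zero_add]
  have hcomm : ∀ f, Eu (Ew f) = Ew (Eu f) := fun f => twist_comm u w f
  -- `xForm w * q j` equals `Ew p` on the line; the `u`-derivative of `hq j` then gives `Eu (q j)`
  have hterm : ∀ j ∈ Finset.univ.erase i,
      xForm w ^ 2 * (C (A.mult j : ℂ) * π (Eu (q j)))
        = C ((A.mult j : ℂ) * (u ⬝ᵥ A.vec j) / (w ⬝ᵥ A.vec j))
          * (xForm w * π (q i) - π (Ew p)) := by
    intro j hj
    have hs : w ⬝ᵥ A.vec j ≠ 0 := (rot_dotProduct_ne_zero_iff _ _).mpr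
      (A.noncollinear i j (Finset.ne_of_mem_erase hj).symm)
    have hj1 := hq j
    set c := u ⬝ᵥ A.vec j with hc
    set d := w ⬝ᵥ A.vec j with hd
    rw [eq_frame hu (A.vec j), ← hc, ← hw, ← hd, xForm_comb, twist_comb] at hj1
    change _ = C c * Eu p + C d * Ew p at hj1
    have hj2 := congrArg (fun f => Eu f) hj1
    have hEw' : ∀ f, Eu (xForm w * f) = xForm w * Eu f := fun f => by
      rw [hEu, twist_xForm_mul, huw, C_0, zero_mul, zero_add]
    simp only [add_mul, mul_assoc, map_add] at hj2
    rw [hEu] at hj2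
    simp only [twist_C_mul] at hj2
    rw [← hEu, hEuu, hEw', hcomm, hqi, hEwu, hEuu] at hj2
    have h1 := congrArg π hj1
    have h2 := congrArg π hj2
    have hπC : ∀ z : ℂ, π (C z) = C z := fun z => hyperRestrict_C u z
    rw [hqi] at h1
    simp only [map_add, map_mul, hπC, hπu, hπw, zero_mul, mul_zero, add_zero, zero_add] at h1 h2
    have hdC : (C d : Poly 2) ≠ 0 := by rwa [Ne, C_eq_zero]
    apply mul_left_cancel₀ hdC
    apply mul_left_cancel₀ hdC
    have h3 : (C d : Poly 2) * C ((A.mult j : ℂ) * c / d) = C (A.mult j : ℂ) * C c := by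
      rw [← C_mul, ← C_mul, mul_div_cancel₀ _ hs]
    linear_combination C d * C (A.mult j : ℂ) * xForm w * h2
      - C (A.mult j : ℂ) * C c * h1 - C d * (xForm w * π (q i) - π (Ew p)) * h3
  have hsum : π (∑ j ∈ Finset.univ.erase i, C (A.mult j : ℂ) * Eu (q j)) = 0 := by
    have h1 : xForm w ^ 2 * ∑ j ∈ Finset.univ.erase i, C (A.mult j : ℂ) * π (Eu (q j)) = 0 := by
      rw [Finset.mul_sum, Finset.sum_congr rfl hterm, ← Finset.sum_mul, ← map_sum]
      rw [IsEquilibrium] at hA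
      rw [hA, C_0, zero_mul]
    have h2 := (mul_eq_zero.mp h1).resolve_left (pow_ne_zero _ hw0)
    rw [← h2, map_sum]
    exact Finset.sum_congr rfl fun j _ => by rw [map_mul, hπ, hyperRestrict_C]
  rw [← hyperRestrict_eq_zero_iff hu0]
  have hΛ := iterate_twist_lam_mul (lamForm u) u 1 p
  rw [Function.iterate_one, ← hEu] at hΛ
  have htwo : Eu (2 * ∑ j, C (A.mult j : ℂ) * q j)
      = 2 * (Eu (q i) + ∑ j ∈ Finset.univ.erase i, C (A.mult j : ℂ) * Eu (q j)) := by
    rw [two_mul, map_add, ← two_mul, ← Finset.add_sum_erase _ _ (Finset.mem_univ i), map_add,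
      map_sum, hi]
    simp only [hEu, twist_C_mul]
    simp
  rw [calogeroStep, laplacian_frame hu]
  change π (Eu (Eu (Eu p) + Ew (Ew p) - _ - _)) = 0
  rw [map_sub Eu, map_sub Eu, map_add Eu, hΛ, htwo, hcomm, hcomm, hqi, hEwu, hEwu, hEuu, map_add Eu, hEuu]
  simp only [map_sub, map_add, map_mul, hπu, hsum, map_ofNat]
  ring

section Reflection

variable {u : Fin 2 → ℂ} {m : ℕ} {p : Poly 2}

theorem xForm_dvd_twist {u w : Fin 2 → ℂ} (hwu : w ⬝ᵥ u = 0) {l : Poly 2} {f : Poly 2}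
    (h : xForm u ∣ f) : xForm u ∣ twist l w f := by
  obtain ⟨g, rfl⟩ := h
  rw [twist_xForm_mul, hwu, C_0, zero_mul, zero_add]
  exact dvd_mul_right _ _

theorem iterate_twist_xForm_rot_mul (u : Fin 2 → ℂ) (l : Poly 2) (k : ℕ) (f : Poly 2) :
    (twist l u)^[k] (xForm (rot u) * f) = xForm (rot u) * (twist l u)^[k] f := by
  rcases k with _ | k
  · rfl
  · rw [iterate_twist_xForm_mul, dotProduct_rot_self, mul_zero, C_0, zero_mul, zero_add]

theorem IsQuasiInvariant.twist_rot (h : IsQuasiInvariant (lamForm u) u m p) :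
    IsQuasiInvariant (lamForm u) u m (twist (lamForm (rot u)) (rot u) p) := by
  intro s hs
  have hc : Function.Commute (twist (lamForm u) u) (twist (lamForm (rot u)) (rot u)) :=
    fun f => twist_comm u (rot u) f
  rw [(hc.iterate_left (2 * s + 1)) p]
  exact xForm_dvd_twist (rot_dotProduct_self u) (h s hs)

theorem IsQuasiInvariant.xForm_rot_mul {l : Poly 2} (h : IsQuasiInvariant l u m p) :
    IsQuasiInvariant l u m (xForm (rot u) * p) := by
  intro s hs
  rw [iterate_twist_xForm_rot_mul]
  exact (h s hs).mul_left _

theorem IsQuasiInvariant.xForm_mul_twist {l : Poly 2} (h : IsQuasiInvariant l u m p) :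
    IsQuasiInvariant l u m (xForm u * twist l u p) := by
  intro s hs
  rw [iterate_twist_xForm_mul, ← Function.iterate_succ_apply]
  exact dvd_add ((h s hs).mul_left _) (dvd_mul_right _ _)

/-- Quasi-invariance is not affected by a division by a quadratic form that is even with respect
to the line and does not vanish on it. -/
theorem IsQuasiInvariant.of_even_mul {l : Poly 2} (hu : u ⬝ᵥ u = 1) {a b : ℂ} (ha : a ≠ 0)
    (h : IsQuasiInvariant l u m ((C a * xForm (rot u) ^ 2 - C b * xForm u ^ 2) * p)) :
    IsQuasiInvariant l u m p := by
  have hu0 : u ⬝ᵥ u ≠ 0 := by rw [hu]; exact one_ne_zero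
  have hrot : ¬ xForm u ∣ xForm (rot u) := by
    rw [← hyperRestrict_eq_zero_iff hu0, hyperRestrict_xForm, dotProduct_rot_self, zero_div, C_0,
      zero_mul, sub_zero]
    apply xForm_ne_zero
    intro h
    apply ne_zero_of_nonisotropic hu0
    have h0 := congrFun h 0
    have h1 := congrFun h 1
    funext k
    fin_cases k
    · simpa [rot] using h1
    · simpa [rot] using h0
  have hsq : ∀ k, (twist l u)^[k] ((C a * xForm (rot u) ^ 2 - C b * xForm u ^ 2) * p)
      = C a * (xForm (rot u) ^ 2 * (twist l u)^[k] p)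
        + C (-b) * (twist l u)^[k] (xForm u * (xForm u * p)) := by
    intro k
    rw [show (C a * xForm (rot u) ^ 2 - C b * xForm u ^ 2) * p
      = C a * (xForm (rot u) * (xForm (rot u) * p)) + C (-b) * (xForm u * (xForm u * p)) by
        rw [C_neg]; ring, iterate_twist_add, iterate_twist_smul, iterate_twist_smul,
      iterate_twist_xForm_rot_mul, iterate_twist_xForm_rot_mul]
    ring
  have hcancel : ∀ k, xForm u ∣ C a * (xForm (rot u) ^ 2 * (twist l u)^[k] p) →
      xForm u ∣ (twist l u)^[k] p := by
    intro k hk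
    rw [xForm_dvd_C_mul_iff ha] at hk
    exact ((xForm_prime hu0).dvd_or_dvd hk).resolve_left
      fun h => hrot ((xForm_prime hu0).dvd_of_dvd_pow h)
  intro s
  induction s with
  | zero =>
    intro hs
    have h1 := h 0 hs
    rw [hsq, mul_zero, zero_add] at h1
    rw [mul_zero, zero_add]
    refine hcancel 1 ((dvd_add_left (Dvd.dvd.mul_left ?_ _)).mp h1)
    rw [show (1 : ℕ) = 0 + 1 from rfl, iterate_twist_xForm_mul]
    exact dvd_add (((dvd_mul_right _ _)).mul_left _) (dvd_mul_right _ _)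
  | succ s ih =>
    intro hs
    have h1 := h (s + 1) hs
    have h2 := ih (by omega)
    rw [hsq] at h1
    refine hcancel _ ((dvd_add_left (Dvd.dvd.mul_left ?_ _)).mp h1)
    rw [iterate_twist_xForm_mul, show 2 * (s + 1) = 2 * s + 1 + 1 by ring, iterate_twist_xForm_mul]
    exact dvd_add ((dvd_add (h2.mul_left _) (dvd_mul_right _ _)).mul_left _) (dvd_mul_right _ _)

end Reflection

/-- At a line of any multiplicity, the Calogero-Moser operator preserves quasi-invariance if the
configuration is symmetric with respect to the reflection in the line. The radial part
`∂_u² - 2 m / (u, x) ∂_u` annihilates `(u, x)^{2m+1}`, the lowest odd power that a quasi-invariant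
may contain, and the remaining terms are even. -/
theorem isQuasiInvariant_calogeroStep_of_symmetric {n : ℕ} (A : Configuration 2 n)
    (i : Fin (n + 1)) (hu : A.vec i ⬝ᵥ A.vec i = 1) (σ : Equiv.Perm (Fin (n + 1))) (hσi : σ i = i)
    (hσm : ∀ j, A.mult (σ j) = A.mult j)
    (hσ : ∀ j, ∃ ε : ℂ, ε ≠ 0 ∧ A.vec (σ j)
      = ε • ((-(A.vec i ⬝ᵥ A.vec j)) • A.vec i + (rot (A.vec i) ⬝ᵥ A.vec j) • rot (A.vec i)))
    (p : Poly 2) (q : Fin (n + 1) → Poly 2)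
    (hp : IsQuasiInvariant (lamForm (A.vec i)) (A.vec i) (A.mult i) p)
    (hq : ∀ j, xForm (A.vec j) * q j = twist (lamForm (A.vec j)) (A.vec j) p) :
    IsQuasiInvariant (lamForm (A.vec i)) (A.vec i) (A.mult i) (calogeroStep A p q) := by
  classical
  set u := A.vec i with hu'
  have hu0 : u ⬝ᵥ u ≠ 0 := A.nonisotropic i
  set w := rot u with hw
  set Eu := twist (lamForm u) u with hEu
  set Ew := twist (lamForm w) w with hEw
  have hqi : Eu p = xForm u * q i := (hq i).symm
  -- the terms `j ≠ i`, grouped in pairs of mirror images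
  have hpair : ∀ j ∈ Finset.univ.erase i,
      IsQuasiInvariant (lamForm u) u (A.mult i) (q j + q (σ j)) := by
    intro j hj
    have hd0 : w ⬝ᵥ A.vec j ≠ 0 := (rot_dotProduct_ne_zero_iff _ _).mpr
      (A.noncollinear i j (Finset.ne_of_mem_erase hj).symm)
    obtain ⟨ε, hε, hεj⟩ := hσ j
    have h1 := hq j
    have h2 := hq (σ j)
    set c := u ⬝ᵥ A.vec j with hc
    set d := w ⬝ᵥ A.vec j with hd
    rw [eq_frame hu (A.vec j), ← hc, ← hw, ← hd, xForm_comb, twist_comb] at h1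
    rw [hεj, smul_add, smul_smul, smul_smul, xForm_comb, twist_comb] at h2
    change _ = C c * Eu p + C d * Ew p at h1
    change _ = C (ε * -c) * Eu p + C (ε * d) * Ew p at h2
    have h2' : (-C c * xForm u + C d * xForm w) * q (σ j) = -C c * Eu p + C d * Ew p := by
      have hεC : (C ε : Poly 2) ≠ 0 := by rwa [Ne, C_eq_zero]
      apply mul_left_cancel₀ hεC
      simp only [C_mul, C_neg] at h2
      linear_combination h2
    refine IsQuasiInvariant.of_even_mul hu (a := d ^ 2) (b := c ^ 2) (pow_ne_zero _ hd0) ?_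
    have : (C (d ^ 2) * xForm w ^ 2 - C (c ^ 2) * xForm u ^ 2) * (q j + q (σ j))
        = C (2 * d ^ 2) * (xForm w * Ew p) + C (-2 * c ^ 2) * (xForm u * Eu p) := by
      have hC2 : (C (2 : ℂ) : Poly 2) = 2 := map_ofNat C 2
      have hCm2 : (C (-2 : ℂ) : Poly 2) = -2 := by rw [C_neg, hC2]
      simp only [C_mul, C_pow, hC2, hCm2]
      linear_combination (C d * xForm w - C c * xForm u) * h1
        + (C d * xForm w + C c * xForm u) * h2'
    rw [← hw, this]
    exact (hp.twist_rot.xForm_rot_mul.C_mul _).add (hp.xForm_mul_twist.C_mul _)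
  have hrest : IsQuasiInvariant (lamForm u) u (A.mult i)
      (2 * ∑ j ∈ Finset.univ.erase i, C (A.mult j : ℂ) * q j) := by
    have h1 : ∑ j ∈ Finset.univ.erase i, C (A.mult j : ℂ) * q (σ j)
        = ∑ j ∈ Finset.univ.erase i, C (A.mult j : ℂ) * q j := by
      refine Finset.sum_equiv σ (fun j => ?_) (fun j _ => by rw [hσm])
      simp only [Finset.mem_erase, Finset.mem_univ, and_true]
      rw [not_iff_not, ← σ.injective.eq_iff (a := j), hσi]
    have h2 : 2 * ∑ j ∈ Finset.univ.erase i, C (A.mult j : ℂ) * q j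
        = ∑ j ∈ Finset.univ.erase i, C (A.mult j : ℂ) * (q j + q (σ j)) := by
      simp only [mul_add, Finset.sum_add_distrib]
      rw [h1, two_mul]
    rw [h2]
    exact IsQuasiInvariant.sum _ fun j hj => (hpair j hj).C_mul _
  have hradial : IsQuasiInvariant (lamForm u) u (A.mult i)
      (Eu (Eu p) + C (-2 * (A.mult i : ℂ)) * q i) := by
    obtain ⟨r, hr⟩ : ∃ r, A.mult i = r + 1 := ⟨A.mult i - 1, by have := A.mult_pos i; omega⟩
    rw [hr] at hp ⊢
    have hqr := hp.quotient hu0 hqi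
    intro s hs
    rw [iterate_twist_add, iterate_twist_smul, ← hEu, ← Function.iterate_succ_apply Eu, hqi, hEu,
      iterate_twist_xForm_mul, hu, add_right_comm]
    refine dvd_add ?_ (dvd_mul_right _ _)
    rw [← add_mul, ← C_add]
    rcases Nat.lt_or_ge s r with h | h
    · exact (hqr s h).mul_left _
    · obtain rfl : s = r := by omega
      have : (((2 * s + 1 : ℕ) : ℂ) + 1) * 1 + -2 * ((s + 1 : ℕ) : ℂ) = 0 := by push_cast; ring
      rw [this, C_0, zero_mul]
      exact dvd_zero _
  have hΛ : IsQuasiInvariant (lamForm u) u (A.mult i) ((∑ k, X (Sum.inl k) ^ 2) * p) := by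
    intro s hs
    rw [iterate_twist_lam_mul]
    exact (hp s hs).mul_left _
  have hfin : calogeroStep A p q = (Eu (Eu p) + C (-2 * (A.mult i : ℂ)) * q i) + Ew (Ew p)
      + C (-1) * ((∑ k, X (Sum.inl k) ^ 2) * p)
      + C (-1) * (2 * ∑ j ∈ Finset.univ.erase i, C (A.mult j : ℂ) * q j) := by
    have hC2 : (C (2 : ℂ) : Poly 2) = 2 := map_ofNat C 2
    rw [calogeroStep, laplacian_frame hu, ← Finset.add_sum_erase _ _ (Finset.mem_univ i)]
    change Eu (Eu p) + Ew (Ew p) - _ - _ = _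
    simp only [C_mul, C_neg, hC2, C_1]
    ring
  rw [hfin]
  exact ((hradial.add hp.twist_rot.twist_rot).add (hΛ.C_mul _)).add (hrest.C_mul _)

end BakerAkhiezer

/-! ### The equilibrium equations and the Gegenbauer polynomial -/

namespace BakerAkhiezer

open Polynomial

/-- The number `binom(n, k) binom(m + k - 1, k) / binom(m + n - 1, k)`. -/
noncomputable def gegenbauerCoeff (m n k : ℕ) : ℂ :=
  (n.choose k : ℂ) * ((m + k - 1).choose k : ℂ) / ((m + n - 1).choose k : ℂ)

/-- The monic polynomial `∑ gegenbauerCoeff m n k * X ^ (n - k)`. Up to a factor, its value at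
`exp (2 i φ)` is `exp (i n φ) C_n^{(m)}(cos φ)` with the Gegenbauer polynomial `C_n^{(m)}`. -/
noncomputable def gegenbauerPoly (m n : ℕ) : ℂ[X] :=
  ∑ k ∈ Finset.range (n + 1), C (gegenbauerCoeff m n k) * X ^ (n - k)

/-- The hypergeometric operator that annihilates `gegenbauerPoly m n`. -/
noncomputable def gegenbauerOp (m n : ℕ) (Q : ℂ[X]) : ℂ[X] :=
  X * (X * derivative (derivative Q)) - X * derivative (derivative Q)
    + C ((m : ℂ) - n + 1) * (X * derivative Q) + C ((m : ℂ) + n - 1) * derivative Q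
    - C ((n : ℂ) * m) * Q

/-- The equilibrium equations in the variables `z_j = exp (2 i φ_j)`: up to a factor, the summands
are `cot (φ_i - φ_j)` and `m cot φ_i`. -/
def IsBethe (m : ℕ) {n : ℕ} (z : Fin n → ℂ) : Prop :=
  ∀ i, ∑ j ∈ Finset.univ.erase i, (z i + z j) / (z i - z j) + m * ((z i + 1) / (z i - 1)) = 0

theorem gegenbauerCoeff_zero (m n : ℕ) : gegenbauerCoeff m n 0 = 1 := by simp [gegenbauerCoeff]

theorem gegenbauerCoeff_pos {m n k : ℕ} (hm : 1 ≤ m) (hk : k ≤ n) :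
    ∃ r : ℝ, 0 < r ∧ gegenbauerCoeff m n k = r := by
  refine ⟨(n.choose k : ℝ) * ((m + k - 1).choose k : ℝ) / ((m + n - 1).choose k : ℝ), ?_, ?_⟩
  · have h1 : 0 < n.choose k := Nat.choose_pos hk
    have h2 : 0 < (m + k - 1).choose k := Nat.choose_pos (by omega)
    have h3 : 0 < (m + n - 1).choose k := Nat.choose_pos (by omega)
    positivity
  · simp [gegenbauerCoeff]

theorem gegenbauerCoeff_succ {m n k : ℕ} (hm : 1 ≤ m) (hk : k < n) :
    gegenbauerCoeff m n (k + 1) * (((k : ℂ) + 1) * ((m : ℂ) + n - 1 - k))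
      = gegenbauerCoeff m n k * (((n : ℂ) - k) * ((m : ℂ) + k)) := by
  have h1 : (n.choose (k + 1) : ℂ) * ((k : ℂ) + 1) = n.choose k * ((n : ℂ) - k) := by
    have := Nat.choose_succ_right_eq n k
    rw [← Nat.cast_sub hk.le]
    exact_mod_cast this
  have h2 : ((m + n - 1).choose (k + 1) : ℂ) * ((k : ℂ) + 1)
      = (m + n - 1).choose k * ((m : ℂ) + n - 1 - k) := by
    have := Nat.choose_succ_right_eq (m + n - 1) k
    have hc : ((m : ℂ) + n - 1 - k) = ((m + n - 1 - k : ℕ) : ℂ) := by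
      rw [Nat.cast_sub (by omega), Nat.cast_sub (by omega)]; push_cast; ring
    rw [hc]
    exact_mod_cast this
  have h3 : ((m + (k + 1) - 1).choose (k + 1) : ℂ) * ((k : ℂ) + 1)
      = (m + k - 1).choose k * ((m : ℂ) + k) := by
    obtain ⟨r, rfl⟩ : ∃ r, m = r + 1 := ⟨m - 1, by omega⟩
    have := Nat.add_one_mul_choose_eq (r + k) k
    rw [show r + 1 + (k + 1) - 1 = r + k + 1 by omega, show r + 1 + k - 1 = r + k by omega]
    have h : ((r + k + 1 : ℕ) : ℂ) * ((r + k).choose k : ℂ)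
        = ((r + k + 1).choose (k + 1) : ℂ) * ((k + 1 : ℕ) : ℂ) := by exact_mod_cast this
    push_cast at h ⊢
    linear_combination -h
  have hk1 : (k : ℂ) + 1 ≠ 0 := by exact_mod_cast k.succ_ne_zero
  have hc1 : ((m + n - 1).choose k : ℂ) ≠ 0 := by
    exact_mod_cast (Nat.choose_pos (by omega)).ne'
  have hc2 : ((m + n - 1).choose (k + 1) : ℂ) ≠ 0 := by
    exact_mod_cast (Nat.choose_pos (by omega)).ne'
  rw [gegenbauerCoeff, gegenbauerCoeff]
  rw [div_mul_eq_mul_div, div_mul_eq_mul_div, div_eq_div_iff hc2 hc1]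
  apply mul_left_cancel₀ hk1
  generalize (n.choose (k + 1) : ℂ) = a at *
  generalize ((m + n - 1).choose (k + 1) : ℂ) = b at *
  generalize ((m + (k + 1) - 1).choose (k + 1) : ℂ) = c at *
  generalize (n.choose k : ℂ) = a' at *
  generalize ((m + n - 1).choose k : ℂ) = b' at *
  generalize ((m + k - 1).choose k : ℂ) = c' at *
  linear_combination (k + 1 : ℂ) * b' * (m + n - 1 - k) * c * h1
    + b' * (m + n - 1 - k) * a' * (n - k) * h3 - a' * c' * (n - k) * (m + k) * h2

theorem coeff_gegenbauerPoly {m n k : ℕ} (hk : k ≤ n) :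
    (gegenbauerPoly m n).coeff (n - k) = gegenbauerCoeff m n k := by
  rw [gegenbauerPoly, finsetSum_coeff, Finset.sum_eq_single k]
  · simp
  · intro j hj hjk
    have := Finset.mem_range.mp hj
    rw [coeff_C_mul, coeff_X_pow, if_neg (by omega), mul_zero]
  · intro h
    exact absurd (Finset.mem_range.mpr (by omega)) h

theorem natDegree_gegenbauerPoly_le (m n : ℕ) : (gegenbauerPoly m n).natDegree ≤ n := by
  refine natDegree_sum_le_of_forall_le _ _ fun k _ => ?_
  exact (natDegree_C_mul_X_pow_le _ _).trans (Nat.sub_le _ _)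

theorem gegenbauerPoly_monic (m n : ℕ) : (gegenbauerPoly m n).Monic := by
  refine monic_of_natDegree_le_of_coeff_eq_one n (natDegree_gegenbauerPoly_le m n) ?_
  simpa [gegenbauerCoeff_zero] using coeff_gegenbauerPoly (m := m) (n := n) (k := 0) (by omega)

theorem natDegree_gegenbauerPoly (m n : ℕ) : (gegenbauerPoly m n).natDegree = n := by
  refine le_antisymm (natDegree_gegenbauerPoly_le m n) (le_natDegree_of_ne_zero ?_)
  have := coeff_gegenbauerPoly (m := m) (n := n) (k := 0) (by omega)
  rw [Nat.sub_zero, gegenbauerCoeff_zero] at this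
  rw [this]
  exact one_ne_zero

theorem coeff_gegenbauerOp (m n : ℕ) (Q : ℂ[X]) (l : ℕ) :
    (gegenbauerOp m n Q).coeff l = Q.coeff l * (((l : ℂ) - n) * ((l : ℂ) + m))
      + Q.coeff (l + 1) * (((l : ℂ) + 1) * ((m : ℂ) + n - 1 - l)) := by
  rcases l with _ | _ | l <;>
    simp only [gegenbauerOp, coeff_add, coeff_sub, coeff_C_mul, coeff_X_mul, coeff_X_mul_zero,
      coeff_derivative, zero_add] <;> push_cast <;> ring

/-- A monic polynomial of degree `n` is annihilated by the operator if and only if it is the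
Gegenbauer polynomial: the recursion for the coefficients determines them from the leading one. -/
theorem gegenbauerOp_eq_zero_iff {m n : ℕ} (hm : 1 ≤ m) {Q : ℂ[X]} (hQ : Q.Monic)
    (hn : Q.natDegree = n) : gegenbauerOp m n Q = 0 ↔ Q = gegenbauerPoly m n := by
  have hbig : ∀ l, n < l → Q.coeff l = 0 := fun l hl => coeff_eq_zero_of_natDegree_lt (by omega)
  have hlead : Q.coeff n = 1 := by rw [← hn]; exact hQ
  have hcast : ∀ k, k < n → ((n - (k + 1) : ℕ) : ℂ) = (n : ℂ) - k - 1 := fun k hk => by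
    rw [Nat.cast_sub (by omega)]; push_cast; ring
  constructor
  · intro h
    have key : ∀ k, k ≤ n → Q.coeff (n - k) = gegenbauerCoeff m n k := by
      intro k
      induction k with
      | zero => intro _; rw [Nat.sub_zero, hlead, gegenbauerCoeff_zero]
      | succ k ih =>
        intro hk
        have h1 := coeff_gegenbauerOp m n Q (n - (k + 1))
        rw [h, coeff_zero, show n - (k + 1) + 1 = n - k by omega, ih (by omega),
          hcast k (by omega)] at h1
        have h2 := gegenbauerCoeff_succ hm (show k < n by omega)
        have h3 : ((k : ℂ) + 1) * ((m : ℂ) + n - 1 - k) ≠ 0 := by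
          refine mul_ne_zero (by exact_mod_cast k.succ_ne_zero) ?_
          have : ((m : ℂ) + n - 1 - k) = ((m + n - 1 - k : ℕ) : ℂ) := by
            rw [Nat.cast_sub (by omega), Nat.cast_sub (by omega)]; push_cast; ring
          rw [this]
          exact_mod_cast (show m + n - 1 - k ≠ 0 by omega)
        apply mul_right_cancel₀ h3
        rw [h2]
        linear_combination h1
    ext l
    rcases Nat.lt_or_ge n l with hl | hl
    · rw [hbig l hl]
      exact (coeff_eq_zero_of_natDegree_lt
        (lt_of_le_of_lt (natDegree_gegenbauerPoly_le m n) hl)).symm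
    · obtain ⟨k, hk, rfl⟩ : ∃ k, k ≤ n ∧ l = n - k := ⟨n - l, by omega, by omega⟩
      rw [key k hk, coeff_gegenbauerPoly hk]
  · rintro rfl
    ext l
    rw [coeff_gegenbauerOp, coeff_zero]
    rcases Nat.lt_or_ge l n with hl | hl
    · obtain ⟨k, hk, rfl⟩ : ∃ k, k < n ∧ l = n - (k + 1) := ⟨n - (l + 1), by omega, by omega⟩
      rw [show n - (k + 1) + 1 = n - k by omega, coeff_gegenbauerPoly (by omega),
        coeff_gegenbauerPoly (by omega), hcast k hk]
      linear_combination -gegenbauerCoeff_succ hm hk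
    · rw [hbig (l + 1) (by omega)]
      rcases eq_or_lt_of_le hl with rfl | hl
      · simp
      · rw [hbig l hl]; simp

section Nodal

variable {n : ℕ}

theorem monic_nodal (z : Fin n → ℂ) : (∏ j, (X - C (z j))).Monic :=
  monic_prod_of_monic _ _ fun j _ => monic_X_sub_C (z j)

theorem natDegree_nodal (z : Fin n → ℂ) : (∏ j, (X - C (z j))).natDegree = n := by
  rw [natDegree_prod_of_monic _ _ fun j _ => monic_X_sub_C (z j)]
  simp

/-- The value of the Gegenbauer operator on `∏ (X - z_j)` at `z_i` is a multiple of the `i`-th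
equilibrium equation, since `Q''(z_i) / Q'(z_i) = ∑ 2 / (z_i - z_j)`. -/
theorem eval_gegenbauerOp_nodal (m : ℕ) {z : Fin n → ℂ} (hz : Function.Injective z)
    (h1 : ∀ i, z i ≠ 1) (i : Fin n) :
    (gegenbauerOp m n (∏ j, (X - C (z j)))).eval (z i)
      = (z i - 1) * (∏ j ∈ Finset.univ.erase i, (z i - z j))
        * (∑ j ∈ Finset.univ.erase i, (z i + z j) / (z i - z j)
          + m * ((z i + 1) / (z i - 1))) := by
  classical
  have hne : ∀ j ∈ Finset.univ.erase i, z i - z j ≠ 0 := fun j hj =>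
    sub_ne_zero.mpr fun h => Finset.ne_of_mem_erase hj (hz h).symm
  set R : ℂ[X] := ∏ j ∈ Finset.univ.erase i, (X - C (z j)) with hR
  have hQ : ∏ j, (X - C (z j)) = (X - C (z i)) * R :=
    (Finset.mul_prod_erase _ _ (Finset.mem_univ i)).symm
  have hRi : R.eval (z i) = ∏ j ∈ Finset.univ.erase i, (z i - z j) := by
    rw [hR, eval_prod]; simp
  have hR' : (derivative R).eval (z i)
      = R.eval (z i) * ∑ j ∈ Finset.univ.erase i, 1 / (z i - z j) := by
    rw [hR, derivative_prod_finset, eval_finsetSum, Finset.mul_sum]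
    refine Finset.sum_congr rfl fun j hj => ?_
    rw [← Finset.mul_prod_erase _ _ hj]
    simp only [eval_mul, derivative_sub, derivative_X, derivative_C, eval_sub, eval_X, eval_C,
      sub_zero, mul_one]
    have := hne j hj
    field_simp
  have hsum : ∑ j ∈ Finset.univ.erase i, (z i + z j) / (z i - z j)
      = 2 * z i * (∑ j ∈ Finset.univ.erase i, 1 / (z i - z j)) - ((n : ℂ) - 1) := by
    have hcard : ((Finset.univ.erase i).card : ℂ) = (n : ℂ) - 1 := by
      have := Finset.card_erase_add_one (Finset.mem_univ i)
      rw [Finset.card_univ, Fintype.card_fin] at this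
      rw [eq_sub_iff_add_eq]
      exact_mod_cast this
    rw [← hcard, Finset.mul_sum, Finset.card_eq_sum_ones, Nat.cast_sum, ← Finset.sum_sub_distrib]
    refine Finset.sum_congr rfl fun j hj => ?_
    have := hne j hj
    field_simp
    push_cast
    ring
  have h0 : z i - 1 ≠ 0 := sub_ne_zero.mpr (h1 i)
  rw [hQ, hsum, ← hRi, gegenbauerOp]
  simp only [derivative_mul, derivative_add, derivative_sub, derivative_X, derivative_C, sub_zero,
    one_mul, eval_add, eval_sub, eval_mul, eval_X, eval_C, sub_self, zero_mul, add_zero, hR']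
  field_simp
  ring

theorem isBethe_iff (m : ℕ) (hm : 1 ≤ m) {z : Fin n → ℂ} (hz : Function.Injective z)
    (h1 : ∀ i, z i ≠ 1) : IsBethe m z ↔ ∏ j, (X - C (z j)) = gegenbauerPoly m n := by
  classical
  rw [← gegenbauerOp_eq_zero_iff hm (monic_nodal z) (natDegree_nodal z)]
  constructor
  · intro h
    refine eq_zero_of_degree_lt_of_eval_index_eq_zero Finset.univ (v := z) hz.injOn ?_
      fun i _ => ?_
    · rw [Finset.card_univ, Fintype.card_fin, degree_lt_iff_coeff_zero]
      intro l hl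
      have hbig : ∀ k, n < k → (∏ j, (X - C (z j))).coeff k = 0 := fun k hk =>
        coeff_eq_zero_of_natDegree_lt (by rwa [natDegree_nodal])
      rw [coeff_gegenbauerOp, hbig (l + 1) (by omega)]
      rcases eq_or_lt_of_le hl with rfl | hl
      · simp
      · rw [hbig l hl]; simp
    · rw [eval_gegenbauerOp_nodal m hz h1, h i, mul_zero]
  · intro h i
    have h2 := eval_gegenbauerOp_nodal m hz h1 i
    rw [h, eval_zero, zero_eq_mul] at h2
    refine h2.resolve_left (mul_ne_zero (sub_ne_zero.mpr (h1 i)) (Finset.prod_ne_zero_iff.mpr ?_))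
    exact fun j hj => sub_ne_zero.mpr fun h => Finset.ne_of_mem_erase hj (hz h).symm

theorem nodal_eq_gegenbauerPoly_iff (m : ℕ) (z : Fin n → ℂ) :
    (∏ j, (X - C (z j)) = gegenbauerPoly m n) ↔ ∀ k : ℕ, 1 ≤ k → k ≤ n →
      ((Finset.univ : Finset (Fin n)).val.map z).esymm k =
        (-1) ^ k * (n.choose k : ℂ) * ((m + k - 1).choose k : ℂ) / ((m + n - 1).choose k : ℂ) := by
  have hcoeff : ∀ k, k ≤ n → (∏ j, (X - C (z j))).coeff (n - k)
      = (-1) ^ k * ((Finset.univ : Finset (Fin n)).val.map z).esymm k := by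
    intro k hk
    have h1 := Multiset.prod_X_sub_C_coeff ((Finset.univ : Finset (Fin n)).val.map z)
      (k := n - k) (by simp)
    rw [Multiset.map_map] at h1
    have h2 : Multiset.card ((Finset.univ : Finset (Fin n)).val.map z) - (n - k) = k := by
      simp; omega
    rw [h2] at h1
    exact h1
  have hsq : ∀ k : ℕ, ((-1 : ℂ) ^ k) * (-1) ^ k = 1 := fun k => by
    rw [← mul_pow]; simp
  have hform : ∀ k : ℕ,
      (-1) ^ k * (n.choose k : ℂ) * ((m + k - 1).choose k : ℂ) / ((m + n - 1).choose k : ℂ)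
        = (-1) ^ k * gegenbauerCoeff m n k := fun k => by
    rw [gegenbauerCoeff]; ring
  constructor
  · intro h k _ hk
    have h1 := hcoeff k hk
    rw [h, coeff_gegenbauerPoly hk] at h1
    rw [hform, h1, ← mul_assoc, hsq, one_mul]
  · intro h
    ext l
    rcases Nat.lt_or_ge n l with hl | hl
    · rw [coeff_eq_zero_of_natDegree_lt (by rwa [natDegree_nodal]),
        coeff_eq_zero_of_natDegree_lt (lt_of_le_of_lt (natDegree_gegenbauerPoly_le m n) hl)]
    · obtain ⟨k, hk, rfl⟩ : ∃ k, k ≤ n ∧ l = n - k := ⟨n - l, by omega, by omega⟩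
      rw [hcoeff k hk, coeff_gegenbauerPoly hk]
      rcases Nat.eq_zero_or_pos k with rfl | hk0
      · rw [pow_zero, one_mul, gegenbauerCoeff_zero]
        simp [Multiset.esymm]
      · rw [h k hk0 hk, hform, ← mul_assoc, hsq, one_mul]

theorem exists_perm_of_nodal_eq {z z' : Fin n → ℂ} (hz : Function.Injective z)
    (h : ∏ j, (X - C (z j)) = ∏ j, (X - C (z' j))) :
    ∃ τ : Equiv.Perm (Fin n), ∀ j, z' (τ j) = z j := by
  have : ∀ j, ∃ k, z' k = z j := by
    intro j
    have h1 := congrArg (eval (z j)) h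
    rw [eval_prod, eval_prod, Finset.prod_eq_zero (Finset.mem_univ j) (by simp)] at h1
    obtain ⟨k, _, hk⟩ := Finset.prod_eq_zero_iff.mp h1.symm
    exact ⟨k, by simpa [sub_eq_zero, eq_comm] using hk⟩
  choose τ hτ using this
  have hinj : Function.Injective τ := fun a b hab => hz (by rw [← hτ a, ← hτ b, hab])
  exact ⟨Equiv.ofBijective τ (Finite.injective_iff_bijective.mp hinj), hτ⟩

/-- The equations are invariant under `z ↦ 1 / z`, that is, under the reflection `φ ↦ -φ`. -/
theorem IsBethe.inv {m : ℕ} {z : Fin n → ℂ} (h : IsBethe m z) (h0 : ∀ i, z i ≠ 0)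
    (h1 : ∀ i, z i ≠ 1) (hz : Function.Injective z) : IsBethe m (fun i => (z i)⁻¹) := by
  intro i
  have hi := h0 i
  have e1 : ∀ j ∈ Finset.univ.erase i, ((z i)⁻¹ + (z j)⁻¹) / ((z i)⁻¹ - (z j)⁻¹)
      = -((z i + z j) / (z i - z j)) := by
    intro j hj
    have hj0 := h0 j
    have hij : z i - z j ≠ 0 := sub_ne_zero.mpr fun h => Finset.ne_of_mem_erase hj (hz h).symm
    have hji : z j - z i ≠ 0 := by rw [← neg_sub]; exact neg_ne_zero.mpr hij
    field_simp
    ring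
  have e2 : ((z i)⁻¹ + 1) / ((z i)⁻¹ - 1) = -((z i + 1) / (z i - 1)) := by
    have ha : z i - 1 ≠ 0 := sub_ne_zero.mpr (h1 i)
    have hb : 1 - z i ≠ 0 := by rw [← neg_sub]; exact neg_ne_zero.mpr ha
    field_simp
    ring
  rw [Finset.sum_congr rfl e1, Finset.sum_neg_distrib, e2, mul_neg, ← neg_add, h i, neg_zero]

/-- The reciprocals of the roots of the Gegenbauer polynomial are a permutation of the roots. -/
theorem exists_perm_inv {m : ℕ} (hm : 1 ≤ m) {z : Fin n → ℂ} (hz : Function.Injective z)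
    (h0 : ∀ i, z i ≠ 0) (h1 : ∀ i, z i ≠ 1) (h : ∏ j, (X - C (z j)) = gegenbauerPoly m n) :
    ∃ τ : Equiv.Perm (Fin n), ∀ j, z (τ j) = (z j)⁻¹ := by
  have hinv : Function.Injective fun i => (z i)⁻¹ := fun a b hab => hz (inv_injective hab)
  have hB := ((isBethe_iff m hm hz h1).mpr h).inv h0 h1 hz
  rw [isBethe_iff m hm hinv fun i => inv_ne_one.mpr (h1 i), ← h] at hB
  exact exists_perm_of_nodal_eq hinv hB

end Nodal

/-- The Gegenbauer polynomial has simple roots, different from `0` and `1`. Its coefficients are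
positive, so that it does not vanish at these two points; they are the singular points of the second
order differential equation, which therefore excludes multiple roots. -/
theorem exists_roots_gegenbauerPoly {m : ℕ} (hm : 1 ≤ m) (n : ℕ) :
    ∃ z : Fin n → ℂ, Function.Injective z ∧ (∀ i, z i ≠ 0) ∧ (∀ i, z i ≠ 1) ∧
      ∏ j, (X - C (z j)) = gegenbauerPoly m n := by
  set Q := gegenbauerPoly m n with hQ
  have hQ0 : Q ≠ 0 := (gegenbauerPoly_monic m n).ne_zero
  have hzero : ¬ Q.IsRoot 0 := by
    obtain ⟨r, hr, he⟩ := gegenbauerCoeff_pos (n := n) hm le_rfl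
    rw [IsRoot, ← coeff_zero_eq_eval_zero, ← Nat.sub_self n, hQ, coeff_gegenbauerPoly le_rfl, he]
    exact_mod_cast hr.ne'
  have hone : ¬ Q.IsRoot 1 := by
    have hex : ∀ k : ℕ, ∃ r : ℝ, k ≤ n → 0 < r ∧ gegenbauerCoeff m n k = r := by
      intro k
      rcases Nat.lt_or_ge n k with h | h
      · exact ⟨0, fun h' => absurd h' (by omega)⟩
      · obtain ⟨r, hr⟩ := gegenbauerCoeff_pos hm h
        exact ⟨r, fun _ => hr⟩
    choose r hr using hex
    have : Q.eval 1 = ((∑ k ∈ Finset.range (n + 1), r k : ℝ) : ℂ) := by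
      rw [hQ, gegenbauerPoly, eval_finsetSum, Complex.ofReal_sum]
      refine Finset.sum_congr rfl fun k hk => ?_
      rw [← (hr k (by have := Finset.mem_range.mp hk; omega)).2]
      simp
    rw [IsRoot, this]
    have hpos : 0 < ∑ k ∈ Finset.range (n + 1), r k :=
      Finset.sum_pos (fun k hk => (hr k (by have := Finset.mem_range.mp hk; omega)).1) (by simp)
    exact_mod_cast hpos.ne'
  have hODE : gegenbauerOp m n Q = 0 :=
    (gegenbauerOp_eq_zero_iff hm (gegenbauerPoly_monic m n) (natDegree_gegenbauerPoly m n)).mpr rfl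
  have hsimple : ∀ a, Q.IsRoot a → Q.rootMultiplicity a ≤ 1 := by
    intro a ha
    by_contra hlt
    rw [not_le] at hlt
    have ha0 : a ≠ 0 := by rintro rfl; exact hzero ha
    have ha1 : a ≠ 1 := by rintro rfl; exact hone ha
    have e1 := derivative_rootMultiplicity_of_root ha
    have hroot' : (derivative Q).IsRoot a := by
      by_contra h
      rw [rootMultiplicity_eq_zero h] at e1
      omega
    have e2 := derivative_rootMultiplicity_of_root hroot'
    have hdeg : 1 ≤ n := by
      by_contra h0
      have h00 : n = 0 := by omega
      have : Q.natDegree = n := natDegree_gegenbauerPoly m n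
      rw [h00] at this
      have h3 : derivative Q = 0 := by
        rw [eq_C_of_natDegree_eq_zero this, derivative_C]
      rw [h3] at e1
      rw [rootMultiplicity_zero] at e1
      omega
    set μ := Q.rootMultiplicity a with hμ
    obtain ⟨ν, hν⟩ : ∃ ν, μ = ν + 2 := ⟨μ - 2, by omega⟩
    have d0 : (X - C a) ^ (ν + 1) ∣ Q :=
      (pow_dvd_pow _ (by omega)).trans (pow_rootMultiplicity_dvd Q a)
    have d1 : (X - C a) ^ (ν + 1) ∣ derivative Q := by
      have := pow_rootMultiplicity_dvd (derivative Q) a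
      rwa [e1, hν, show ν + 2 - 1 = ν + 1 by omega] at this
    have d2 : (X - C a) ^ (ν + 1) ∣ (X * (X - 1)) * derivative (derivative Q) := by
      have : (X * (X - 1)) * derivative (derivative Q)
          = C ((n : ℂ) * m) * Q
            - (C ((m : ℂ) - n + 1) * X + C ((m : ℂ) + n - 1)) * derivative Q := by
        rw [gegenbauerOp] at hODE
        linear_combination hODE
      rw [this]
      exact dvd_sub (d0.mul_left _) (d1.mul_left _)
    -- the leading coefficient of the equation does not vanish at `a`, and so the order of `Q''` is
    -- too high
    have d3 : (X - C a) ^ (ν + 1) ∣ derivative (derivative Q) := by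
      refine (prime_X_sub_C a).pow_dvd_of_dvd_mul_left _ ?_ d2
      rw [dvd_iff_isRoot, IsRoot]
      simp [ha0, sub_eq_zero, ha1]
    have hQ'' : derivative (derivative Q) ≠ 0 := by
      intro h0
      have h1 : (derivative Q).natDegree = 0 := derivative_eq_zero.mp h0
      rw [eq_C_of_natDegree_eq_zero h1, IsRoot, eval_C] at hroot'
      have h2 : derivative Q = 0 := by rw [eq_C_of_natDegree_eq_zero h1, hroot', C_0]
      have h3 := derivative_eq_zero.mp h2
      rw [hQ, natDegree_gegenbauerPoly] at h3
      omega
    have := (le_rootMultiplicity_iff hQ'').mpr d3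
    omega
  have hnodup : Q.roots.Nodup := by
    rw [Multiset.nodup_iff_count_le_one]
    intro a
    rw [count_roots]
    by_cases ha : Q.IsRoot a
    · exact hsimple a ha
    · rw [rootMultiplicity_eq_zero ha]; omega
  have hsplit : Q.Splits := IsAlgClosed.splits Q
  have hcard : Q.roots.card = n := by
    rw [← natDegree_gegenbauerPoly m n, ← hQ]
    exact hsplit.natDegree_eq_card_roots.symm
  obtain ⟨L, hL⟩ : ∃ L : List ℂ, (L : Multiset ℂ) = Q.roots := Quot.exists_rep Q.roots
  have hLn : L.length = n := by rw [← hcard, ← hL, Multiset.coe_card]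
  subst hLn
  refine ⟨L.get, ?_, ?_, ?_, ?_⟩
  · rw [← List.nodup_iff_injective_get, ← Multiset.coe_nodup, hL]
    exact hnodup
  · intro i h
    apply hzero
    rw [← h]
    refine isRoot_of_mem_roots ?_
    rw [← hL]
    exact List.get_mem L i
  · intro i h
    apply hone
    rw [← h]
    refine isRoot_of_mem_roots ?_
    rw [← hL]
    exact List.get_mem L i
  · have h1 := prod_multiset_X_sub_C_of_monic_of_roots_card_eq (gegenbauerPoly_monic m L.length)
      (by rw [← hQ, natDegree_gegenbauerPoly]; exact hcard)
    rw [← hQ, ← hL, Multiset.map_coe, Multiset.prod_coe] at h1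
    rw [← h1, ← List.prod_ofFn]
    congr 1
    conv_rhs => rw [← List.ofFn_get L, List.map_ofFn]
    rfl

end BakerAkhiezer

/-! ### Equivalence of configurations -/

namespace BakerAkhiezer

open MvPolynomial

variable {N n : ℕ}

theorem equivalent_symm {A B : Configuration N n} (h : A.Equivalent B) : B.Equivalent A := by
  obtain ⟨O, σ, c, hO, hc, h⟩ := h
  refine ⟨Oᵀ, σ.symm, fun i => (c (σ.symm i))⁻¹, ?_, fun i => inv_ne_zero (hc _), fun i => ?_⟩
  · rw [Matrix.transpose_transpose]
    exact mul_eq_one_comm.mp hO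
  · obtain ⟨h1, h2⟩ := h (σ.symm i)
    rw [Equiv.apply_symm_apply] at h1 h2
    refine ⟨?_, h2.symm⟩
    rw [h1, Matrix.mulVec_smul, Matrix.mulVec_mulVec, hO, Matrix.one_mulVec, smul_smul,
      inv_mul_cancel₀ (hc _), one_smul]

theorem equivalent_trans {A B D : Configuration N n} (h : A.Equivalent B) (h' : B.Equivalent D) :
    A.Equivalent D := by
  obtain ⟨O, σ, c, hO, hc, h⟩ := h
  obtain ⟨O', σ', c', hO', hc', h'⟩ := h'
  refine ⟨O' * O, σ' * σ, fun i => c' (σ i) * c i, ?_, fun i => mul_ne_zero (hc' _) (hc _),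
    fun i => ?_⟩
  · rw [Matrix.transpose_mul, Matrix.mul_assoc, ← Matrix.mul_assoc _ O', hO', Matrix.one_mul, hO]
  · obtain ⟨h1, h2⟩ := h i
    obtain ⟨h1', h2'⟩ := h' (σ i)
    refine ⟨?_, by rw [Equiv.Perm.mul_apply, h2', h2]⟩
    rw [Equiv.Perm.mul_apply, h1', h1, Matrix.mulVec_smul, smul_smul, Matrix.mulVec_mulVec]

/-- The substitution of `O lam` for `lam` and of `O x` for `x`. -/
noncomputable def matrixSubst (O : Matrix (Fin N) (Fin N) ℂ) : Poly N →ₐ[ℂ] Poly N :=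
  aeval (Sum.elim (fun k => lamForm (O k)) (fun k => xForm (O k)))

theorem matrixSubst_C (O : Matrix (Fin N) (Fin N) ℂ) (c : ℂ) : matrixSubst O (C c) = C c := by
  simp [matrixSubst, algebraMap_eq]

theorem matrixSubst_xForm (O : Matrix (Fin N) (Fin N) ℂ) (v : Fin N → ℂ) :
    matrixSubst O (xForm v) = xForm (Oᵀ *ᵥ v) := by
  simp only [matrixSubst, xForm, map_sum, map_mul, aeval_X, Sum.elim_inr, algHom_C, algebraMap_eq,
    Matrix.mulVec, dotProduct, Matrix.transpose_apply, Finset.mul_sum, Finset.sum_mul]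
  rw [Finset.sum_comm]
  refine Finset.sum_congr rfl fun k _ => Finset.sum_congr rfl fun l _ => ?_
  ring

theorem matrixSubst_lamForm (O : Matrix (Fin N) (Fin N) ℂ) (v : Fin N → ℂ) :
    matrixSubst O (lamForm v) = lamForm (Oᵀ *ᵥ v) := by
  simp only [matrixSubst, lamForm, map_sum, map_mul, aeval_X, Sum.elim_inl, algHom_C, algebraMap_eq,
    Matrix.mulVec, dotProduct, Matrix.transpose_apply, Finset.mul_sum, Finset.sum_mul]
  rw [Finset.sum_comm]
  refine Finset.sum_congr rfl fun k _ => Finset.sum_congr rfl fun l _ => ?_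
  ring

theorem matrixSubst_xDeriv (O : Matrix (Fin N) (Fin N) ℂ) (v : Fin N → ℂ) (p : Poly N) :
    matrixSubst O (xDeriv (O *ᵥ v) p) = xDeriv v (matrixSubst O p) := by
  induction p using MvPolynomial.induction_on with
  | C c => simp [matrixSubst]
  | add p q hp hq => simp [hp, hq]
  | mul_X p i hp =>
    have hX : matrixSubst O (xDeriv (O *ᵥ v) (X i)) = xDeriv v (matrixSubst O (X i)) := by
      rcases i with k | k
      · simp [matrixSubst, xDeriv_X_inl, xDeriv_lamForm]
      · rw [xDeriv_X_inr, matrixSubst_C]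
        simp [matrixSubst, xDeriv_xForm, Matrix.mulVec, dotProduct_comm v]
    rw [xDeriv_mul, map_add, map_mul, map_mul, hp, hX, map_mul, xDeriv_mul]

theorem totalDegree_matrixSubst_le (O : Matrix (Fin N) (Fin N) ℂ) (p : Poly N) :
    (matrixSubst O p).totalDegree ≤ p.totalDegree := by
  conv_lhs => rw [← sum_homogeneousComponent p, map_sum]
  refine totalDegree_finsetSum_le fun d hd => ?_
  have h := (homogeneousComponent_isHomogeneous d p).aeval (n := 1)
    (Sum.elim (fun k => lamForm (O k)) (fun k => xForm (O k)) : Fin N ⊕ Fin N → Poly N) (by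
      rintro (k | k)
      · exact lamForm_isHomogeneous _
      · exact xForm_isHomogeneous _)
  have := Finset.mem_range.mp hd
  exact h.totalDegree_le.trans (by omega)

theorem admitsBA_of_equivalent {A B : Configuration N n} (h : A.Equivalent B)
    (hB : B.AdmitsBA) : A.AdmitsBA := by
  obtain ⟨O, σ, c, hO, hc, h⟩ := h
  obtain ⟨P, hP, hQ⟩ := (admitsBA_iff B).mp hB
  have hv : ∀ i, Oᵀ *ᵥ B.vec (σ i) = c i • A.vec i := fun i => by
    rw [(h i).1, Matrix.mulVec_smul, Matrix.mulVec_mulVec, hO, Matrix.one_mulVec]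
  have hsum : ∑ i, B.mult i = ∑ i, A.mult i := by
    rw [← Equiv.sum_comp σ]
    exact Finset.sum_congr rfl fun i _ => (h i).2
  set K : ℂ := ∏ i, c i ^ (2 * A.mult i) with hK
  have hK0 : K ≠ 0 := Finset.prod_ne_zero_iff.mpr fun i _ => pow_ne_zero _ (hc i)
  have hH : matrixSubst O B.highestTerm = C K * A.highestTerm := by
    rw [highestTerm_eq, highestTerm_eq, ← Equiv.prod_comp σ, map_prod, hK, map_prod,
      ← Finset.prod_mul_distrib]
    refine Finset.prod_congr rfl fun i _ => ?_
    rw [map_mul, map_pow, map_pow, matrixSubst_xForm, matrixSubst_lamForm, hv, (h i).2,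
      xForm_smul, lamForm_smul, C_pow]
    ring
  rw [admitsBA_iff]
  refine ⟨C K⁻¹ * matrixSubst O P, ?_, fun i => IsQuasiInvariant.C_mul ?_ _⟩
  · have : C K⁻¹ * matrixSubst O P - A.highestTerm
        = C K⁻¹ * matrixSubst O (P - B.highestTerm) := by
      have h1 : (C K⁻¹ * C K : Poly N) = 1 := by rw [← C_mul, inv_mul_cancel₀ hK0, C_1]
      rw [map_sub, hH]
      linear_combination A.highestTerm * h1
    rw [this, ← hsum]
    refine lt_of_le_of_lt (totalDegree_mul _ _) ?_
    rw [totalDegree_C, zero_add]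
    exact lt_of_le_of_lt (totalDegree_matrixSubst_le _ _) hP
  · have htw : ∀ (k : ℕ), matrixSubst O ((twist (lamForm (B.vec (σ i))) (B.vec (σ i)))^[k] P)
        = C (c i ^ k) * (twist (lamForm (A.vec i)) (A.vec i))^[k] (matrixSubst O P) := by
      intro k
      induction k with
      | zero => simp
      | succ k ih =>
        rw [Function.iterate_succ_apply', twist_apply, map_add, map_mul, ih, matrixSubst_lamForm, hv,
          (h i).1, xDeriv_smul_left, Derivation.smul_apply, map_smul, matrixSubst_xDeriv,
          ← (h i).1, ih, Function.iterate_succ_apply', twist_apply, lamForm_smul, xDeriv_mul,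
          xDeriv_C, MvPolynomial.smul_eq_C_mul, pow_succ, C_mul]
        ring
    intro s hs
    have h1 := map_dvd (matrixSubst O) (hQ (σ i) s (by rwa [(h i).2]))
    rw [htw, matrixSubst_xForm, hv, xForm_smul] at h1
    exact (xForm_dvd_C_mul_iff (pow_ne_zero _ (hc i))).mp ((dvd_mul_left _ _).trans h1)

end BakerAkhiezer

/-! ### Configurations given by angles -/

namespace BakerAkhiezer

variable {n : ℕ}

/-- The unit vector `(cos φ, sin φ)`. -/
noncomputable def unitVec (φ : ℂ) : Fin 2 → ℂ := ![Complex.cos φ, Complex.sin φ]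

/-- The point `exp (2 i φ)`, which determines the line spanned by `unitVec φ`. -/
noncomputable def lineParam (φ : ℂ) : ℂ := Complex.exp (2 * Complex.I * φ)

theorem lineParam_eq_sq (φ : ℂ) : lineParam φ = Complex.exp (φ * Complex.I) ^ 2 := by
  rw [lineParam, ← Complex.exp_nat_mul]; congr 1; push_cast; ring

theorem lineParam_ne_zero (φ : ℂ) : lineParam φ ≠ 0 := Complex.exp_ne_zero _

theorem lineParam_neg (φ : ℂ) : lineParam (-φ) = (lineParam φ)⁻¹ := by
  rw [lineParam, lineParam, ← Complex.exp_neg]; congr 1; ring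

theorem unitVec_zero : unitVec 0 = ![1, 0] := by simp [unitVec]

theorem unitVec_dotProduct_self (φ : ℂ) : unitVec φ ⬝ᵥ unitVec φ = 1 := by
  simp only [unitVec, dotProduct, Fin.sum_univ_two, Matrix.cons_val_zero, Matrix.cons_val_one]
  linear_combination Complex.cos_sq_add_sin_sq φ

theorem unitVec_dotProduct (φ ψ : ℂ) : unitVec φ ⬝ᵥ unitVec ψ
    = (lineParam φ + lineParam ψ)
      / (2 * (Complex.exp (φ * Complex.I) * Complex.exp (ψ * Complex.I))) := by
  have h1 := Complex.exp_ne_zero (φ * Complex.I)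
  have h2 := Complex.exp_ne_zero (ψ * Complex.I)
  simp only [unitVec, dotProduct, Fin.sum_univ_two, Matrix.cons_val_zero, Matrix.cons_val_one,
    lineParam_eq_sq, Complex.cos, Complex.sin, neg_mul, Complex.exp_neg]
  generalize Complex.exp (φ * Complex.I) = a at *
  generalize Complex.exp (ψ * Complex.I) = b at *
  field_simp
  linear_combination (a ^ 2 - 1) * (b ^ 2 - 1) * Complex.I_sq

theorem rot_unitVec_dotProduct (φ ψ : ℂ) : rot (unitVec φ) ⬝ᵥ unitVec ψ
    = Complex.I * (lineParam φ - lineParam ψ)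
      / (2 * (Complex.exp (φ * Complex.I) * Complex.exp (ψ * Complex.I))) := by
  have h1 := Complex.exp_ne_zero (φ * Complex.I)
  have h2 := Complex.exp_ne_zero (ψ * Complex.I)
  simp only [rot, unitVec, dotProduct, Fin.sum_univ_two, Matrix.cons_val_zero, Matrix.cons_val_one,
    lineParam_eq_sq, Complex.cos, Complex.sin, neg_mul, Complex.exp_neg]
  field_simp
  ring

theorem linearIndependent_unitVec_iff (φ ψ : ℂ) :
    LinearIndependent ℂ ![unitVec φ, unitVec ψ] ↔ lineParam φ ≠ lineParam ψ := by
  rw [← rot_dotProduct_ne_zero_iff, rot_unitVec_dotProduct]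
  simp [Complex.exp_ne_zero, sub_eq_zero]

theorem exists_smul_unitVec_of_lineParam_eq {φ ψ : ℂ} (h : lineParam φ = lineParam ψ) :
    ∃ c : ℂ, c ≠ 0 ∧ unitVec φ = c • unitVec ψ := by
  rw [lineParam_eq_sq, lineParam_eq_sq, sq_eq_sq_iff_eq_or_eq_neg] at h
  rcases h with h | h
  · refine ⟨1, one_ne_zero, ?_⟩
    simp [unitVec, Complex.cos, Complex.sin, Complex.exp_neg, h]
  · refine ⟨-1, neg_ne_zero.mpr one_ne_zero, ?_⟩
    simp [unitVec, Complex.cos, Complex.sin, Complex.exp_neg, h, inv_neg]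
    constructor <;> ring

theorem exists_eq_smul_unitVec {v : Fin 2 → ℂ} (hv : v ⬝ᵥ v ≠ 0) :
    ∃ (r φ : ℂ), r ≠ 0 ∧ v = r • unitVec φ := by
  obtain ⟨r, hr⟩ := IsAlgClosed.exists_pow_nat_eq (v ⬝ᵥ v) (n := 2) (by norm_num)
  have hr0 : r ≠ 0 := by rintro rfl; apply hv; rw [← hr]; simp
  simp only [dotProduct, Fin.sum_univ_two] at hr
  have hprod : (v 0 / r + v 1 / r * Complex.I) * (v 0 / r - v 1 / r * Complex.I) = 1 := by
    field_simp
    linear_combination (-v 1 ^ 2) * Complex.I_sq - hr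
  have hne : v 0 / r + v 1 / r * Complex.I ≠ 0 := left_ne_zero_of_mul_eq_one hprod
  set φ := Complex.log (v 0 / r + v 1 / r * Complex.I) / Complex.I with hφ
  have he : Complex.exp (φ * Complex.I) = v 0 / r + v 1 / r * Complex.I := by
    rw [hφ, div_mul_cancel₀ _ Complex.I_ne_zero, Complex.exp_log hne]
  have he' : Complex.exp (-φ * Complex.I) = v 0 / r - v 1 / r * Complex.I := by
    rw [neg_mul, Complex.exp_neg, he]
    exact (eq_inv_of_mul_eq_one_right hprod).symm
  refine ⟨r, φ, hr0, ?_⟩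
  funext k
  fin_cases k
  · simp only [unitVec, Complex.cos, he, he', Pi.smul_apply, smul_eq_mul]
    simp
    field_simp
  · simp only [unitVec, Complex.sin, he, he', Pi.smul_apply, smul_eq_mul]
    simp
    field_simp
    linear_combination (2 * v 1) * Complex.I_sq

/-- The configuration of the unit vectors with given angles. -/
noncomputable def angleConfiguration (φ : Fin (n + 1) → ℂ) (m : Fin (n + 1) → ℕ)
    (hm : ∀ i, 1 ≤ m i) (h : Function.Injective fun i => lineParam (φ i)) :
    Configuration 2 n where
  vec i := unitVec (φ i)
  mult := m
  mult_pos := hm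
  noncollinear i j hij := (linearIndependent_unitVec_iff _ _).mpr fun he => hij (h he)
  nonisotropic i := by rw [unitVec_dotProduct_self]; exact one_ne_zero

/-- Every configuration is equivalent to one given by angles, with `(1, 0)` as the first vector. -/
theorem exists_equivalent_angle (A : Configuration 2 n) :
    ∃ (B : Configuration 2 n) (φ : Fin (n + 1) → ℂ), A.Equivalent B ∧ φ 0 = 0 ∧ B.mult = A.mult ∧
      ∀ i, B.vec i = unitVec (φ i) := by
  choose r φ hr hφ using fun i => exists_eq_smul_unitVec (A.nonisotropic i)
  -- the rotation by the angle `-φ 0`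
  set O : Matrix (Fin 2) (Fin 2) ℂ := !![Complex.cos (φ 0), Complex.sin (φ 0);
    -Complex.sin (φ 0), Complex.cos (φ 0)] with hO
  have hrot : ∀ ψ, O *ᵥ unitVec ψ = unitVec (ψ - φ 0) := by
    intro ψ
    simp only [hO, unitVec, Complex.cos_sub, Complex.sin_sub]
    ext k
    fin_cases k <;> simp [Matrix.mulVec, dotProduct, Fin.sum_univ_two] <;> ring
  have hlin : ∀ ψ, lineParam (ψ - φ 0) = lineParam ψ * (lineParam (φ 0))⁻¹ := by
    intro ψ
    rw [← lineParam_neg, lineParam, lineParam, lineParam, ← Complex.exp_add]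
    congr 1; ring
  have hinj : Function.Injective fun i => lineParam (φ i - φ 0) := by
    intro i j hij
    by_contra hne
    have h1 : lineParam (φ i) = lineParam (φ j) := by
      simp only [hlin] at hij
      exact mul_right_cancel₀ (inv_ne_zero (lineParam_ne_zero _)) hij
    refine (rot_dotProduct_ne_zero_iff _ _).mpr (A.noncollinear i j hne) ?_
    have h2 : rot (r i • unitVec (φ i)) = r i • rot (unitVec (φ i)) := by
      funext k
      fin_cases k <;> simp [rot]
    rw [hφ i, hφ j, h2, smul_dotProduct, dotProduct_smul, rot_unitVec_dotProduct, h1]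
    simp
  refine ⟨angleConfiguration (fun i => φ i - φ 0) A.mult A.mult_pos hinj, fun i => φ i - φ 0,
    ⟨O, 1, fun i => (r i)⁻¹, ?_, fun i => inv_ne_zero (hr i), fun i => ⟨?_, rfl⟩⟩,
    sub_self _, rfl, fun _ => rfl⟩
  · have hcs := Complex.cos_sq_add_sin_sq (φ 0)
    rw [hO]
    ext i j
    fin_cases i <;> fin_cases j <;> simp [Matrix.mul_apply, Fin.sum_univ_two]
    · linear_combination hcs
    · ring
    · ring
    · linear_combination hcs
  · rw [hφ i, Matrix.mulVec_smul, hrot, smul_smul, inv_mul_cancel₀ (hr i), one_smul]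
    rfl

section Angles

variable {A : Configuration 2 n} {φ : Fin (n + 1) → ℂ}

theorem lineParam_injective (hA : ∀ i, A.vec i = unitVec (φ i)) :
    Function.Injective fun i => lineParam (φ i) := by
  intro i j hij
  by_contra hne
  have := A.noncollinear i j hne
  rw [hA, hA, linearIndependent_unitVec_iff] at this
  exact this hij

/-- For a configuration of type `(m, 1^n)` the equilibrium equations of the vectors of multiplicity
one are the Bethe equations for the points `exp (2 i φ_j)`. -/
theorem isEquilibrium_iff (hA : ∀ i, A.vec i = unitVec (φ i)) (h0 : φ 0 = 0) {m : ℕ}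
    (hm : A.HasType m) : (∀ i : Fin n, IsEquilibrium A i.succ) ↔
      IsBethe m fun i : Fin n => lineParam (φ i.succ) := by
  refine forall_congr' fun i => ?_
  set z : Fin (n + 1) → ℂ := fun j => lineParam (φ j) with hz
  have hz0 : z 0 = 1 := by simp [hz, h0, lineParam]
  set f : Fin (n + 1) → ℂ := fun j => A.mult j * ((z i.succ + z j) / (z i.succ - z j)) with hf
  have hterm : ∀ j, (A.mult j : ℂ) * (A.vec i.succ ⬝ᵥ A.vec j) / (rot (A.vec i.succ) ⬝ᵥ A.vec j)
      = -Complex.I * f j := by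
    intro j
    have e1 := Complex.exp_ne_zero (φ i.succ * Complex.I)
    have e2 := Complex.exp_ne_zero (φ j * Complex.I)
    rw [hA, hA, unitVec_dotProduct, rot_unitVec_dotProduct, hf, mul_div_assoc,
      div_div_div_cancel_right₀ (by simp [e1, e2]), mul_comm Complex.I, ← div_div,
      div_eq_mul_inv _ Complex.I, Complex.inv_I]
    ring
  have hsum : ∑ j ∈ Finset.univ.erase i.succ, f j
      = ∑ j ∈ Finset.univ.erase i, (z i.succ + z j.succ) / (z i.succ - z j.succ)
        + m * ((z i.succ + 1) / (z i.succ - 1)) := by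
    have h1 := Finset.add_sum_erase Finset.univ f (Finset.mem_univ i.succ)
    have h2 := Finset.add_sum_erase Finset.univ (fun j : Fin n => f j.succ) (Finset.mem_univ i)
    rw [Fin.sum_univ_succ, ← h2] at h1
    have h3 : f 0 = m * ((z i.succ + 1) / (z i.succ - 1)) := by
      simp only [hf, hm.1, hz0]
    have h4 : ∑ j ∈ Finset.univ.erase i, f j.succ
        = ∑ j ∈ Finset.univ.erase i, (z i.succ + z j.succ) / (z i.succ - z j.succ) :=
      Finset.sum_congr rfl fun j _ => by simp [hf, hm.2 j]
    rw [h3, h4] at h1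
    linear_combination h1
  rw [IsEquilibrium, Finset.sum_congr rfl fun j _ => hterm j, ← Finset.mul_sum, hsum, mul_eq_zero,
    or_iff_right (neg_ne_zero.mpr Complex.I_ne_zero)]

end Angles

/-- The extension of a permutation of `Fin n` to `Fin (n + 1)` that fixes `0`. -/
def extendPerm (τ : Equiv.Perm (Fin n)) : Equiv.Perm (Fin (n + 1)) :=
  Equiv.Perm.decomposeFin.symm (0, τ)

theorem extendPerm_zero (τ : Equiv.Perm (Fin n)) : extendPerm τ 0 = 0 := by
  simp [extendPerm]

theorem extendPerm_succ (τ : Equiv.Perm (Fin n)) (i : Fin n) :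
    extendPerm τ i.succ = (τ i).succ := by
  simp [extendPerm]

theorem exists_angles_of_isAm1n {B : Configuration 2 n} {m : ℕ} (hB : B.IsAm1n m) :
    ∃ φ : Fin (n + 1) → ℂ, φ 0 = 0 ∧ (∀ i, B.vec i = unitVec (φ i)) ∧
      ∏ j : Fin n, (Polynomial.X - Polynomial.C (lineParam (φ j.succ))) = gegenbauerPoly m n := by
  obtain ⟨_, h0, φ, hφ, he⟩ := hB
  refine ⟨Fin.cons 0 φ, rfl, fun i => ?_, ?_⟩
  · refine Fin.cases ?_ (fun j => ?_) i
    · rw [h0, Fin.cons_zero, unitVec_zero]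
    · rw [hφ, Fin.cons_succ, unitVec]
  · rw [nodal_eq_gegenbauerPoly_iff m fun j : Fin n =>
      lineParam ((Fin.cons 0 φ : Fin (n + 1) → ℂ) j.succ)]
    exact he

theorem exists_isAm1n (m n : ℕ) (hm : 1 ≤ m) : ∃ B : Configuration 2 n, B.IsAm1n m := by
  obtain ⟨z, hz, h0, h1, hprod⟩ := exists_roots_gegenbauerPoly hm n
  set φ : Fin n → ℂ := fun i => Complex.log (z i) / (2 * Complex.I) with hφ
  have hφz : ∀ i, lineParam (φ i) = z i := fun i => by
    rw [lineParam, hφ, mul_div_cancel₀ _ (by simp), Complex.exp_log (h0 i)]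
  have hinj : Function.Injective fun i => lineParam ((Fin.cons 0 φ : Fin (n + 1) → ℂ) i) := by
    have : (fun i => lineParam ((Fin.cons 0 φ : Fin (n + 1) → ℂ) i))
        = (Fin.cons 1 z : Fin (n + 1) → ℂ) := by
      funext i
      refine Fin.cases ?_ (fun j => ?_) i
      · simp [lineParam]
      · simp [hφz]
    rw [this, Fin.cons_injective_iff]
    exact ⟨fun ⟨i, hi⟩ => h1 i hi, hz⟩
  refine ⟨angleConfiguration (Fin.cons 0 φ) (Fin.cons m fun _ => 1) ?_ hinj, ⟨rfl, fun _ => rfl⟩,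
    unitVec_zero, φ, fun _ => rfl, ?_⟩
  · intro i
    refine Fin.cases hm (fun j => le_rfl) i
  · have := (nodal_eq_gegenbauerPoly_iff m z).mp hprod
    have hz' : z = fun i => Complex.exp (2 * Complex.I * φ i) := funext fun i => (hφz i).symm
    rwa [hz'] at this

theorem admitsBA_of_isAm1n {B : Configuration 2 n} {m : ℕ} (hm : 1 ≤ m) (hB : B.IsAm1n m) :
    B.AdmitsBA := by
  have htype : B.HasType m := hB.1
  obtain ⟨φ, h0, hφ, hprod⟩ := exists_angles_of_isAm1n hB
  have hinj := lineParam_injective hφ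
  have hz : Function.Injective fun j : Fin n => lineParam (φ j.succ) :=
    fun i j hij => Fin.succ_injective n (hinj hij)
  have hz1 : ∀ j : Fin n, lineParam (φ j.succ) ≠ 1 := by
    intro j hj
    have : lineParam (φ j.succ) = lineParam (φ 0) := by rw [hj, h0]; simp [lineParam]
    exact Fin.succ_ne_zero j (hinj this)
  have hunit : ∀ i, B.vec i ⬝ᵥ B.vec i = 1 := fun i => by rw [hφ, unitVec_dotProduct_self]
  have hE := (isEquilibrium_iff hφ h0 htype).mpr ((isBethe_iff m hm hz hz1).mpr hprod)
  obtain ⟨τ, hτ⟩ := exists_perm_inv hm hz (fun _ => lineParam_ne_zero _) hz1 hprod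
  refine admitsBA_of_calogeroStep B fun p q hp hq i => ?_
  refine Fin.cases ?_ (fun i => ?_) i
  · refine isQuasiInvariant_calogeroStep_of_symmetric B 0 (hunit 0) (extendPerm τ)
      (extendPerm_zero τ) ?_ ?_ p q (hp 0) hq
    · intro j
      refine Fin.cases ?_ (fun j => ?_) j
      · rw [extendPerm_zero]
      · rw [extendPerm_succ, htype.2, htype.2]
    · intro j
      have hpar : lineParam (φ (extendPerm τ j)) = lineParam (-φ j) := by
        rw [lineParam_neg]
        refine Fin.cases ?_ (fun j => ?_) j
        · rw [extendPerm_zero, h0]; simp [lineParam]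
        · rw [extendPerm_succ]; exact hτ j
      obtain ⟨c, hc, hcv⟩ := exists_smul_unitVec_of_lineParam_eq hpar
      refine ⟨-c, neg_ne_zero.mpr hc, ?_⟩
      rw [hφ, hφ, hφ, hcv, h0, unitVec_zero]
      funext k
      fin_cases k <;> simp [unitVec, rot, dotProduct, Fin.sum_univ_two]
  · exact isQuasiInvariant_calogeroStep_of_isEquilibrium B i.succ (htype.2 i) (hunit _) (hE i) p q
      hq

theorem equivalent_of_admitsBA {A B : Configuration 2 n} {m : ℕ} (hm : 1 ≤ m) (hB : B.IsAm1n m)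
    (hA : A.HasType m) (h : A.AdmitsBA) : A.Equivalent B := by
  obtain ⟨D, φ, hAD, h0, hmult, hφ⟩ := exists_equivalent_angle A
  have hD := admitsBA_of_equivalent (equivalent_symm hAD) h
  have hDtype : D.HasType m := by
    rw [Configuration.HasType, hmult]; exact hA
  refine equivalent_trans hAD ?_
  have hinj := lineParam_injective hφ
  have hz : Function.Injective fun j : Fin n => lineParam (φ j.succ) :=
    fun i j hij => Fin.succ_injective n (hinj hij)
  have hz1 : ∀ j : Fin n, lineParam (φ j.succ) ≠ 1 := by
    intro j hj
    have : lineParam (φ j.succ) = lineParam (φ 0) := by rw [hj, h0]; simp [lineParam]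
    exact Fin.succ_ne_zero j (hinj this)
  have hprod := (isBethe_iff m hm hz hz1).mp ((isEquilibrium_iff hφ h0 hDtype).mp
    fun i => isEquilibrium_of_admitsBA D hD i.succ (hDtype.2 i))
  obtain ⟨ψ, hψ0, hψ, hprod'⟩ := exists_angles_of_isAm1n hB
  obtain ⟨τ, hτ⟩ := exists_perm_of_nodal_eq hz (hprod.trans hprod'.symm)
  have hpar : ∀ i, lineParam (ψ (extendPerm τ i)) = lineParam (φ i) := by
    intro i
    refine Fin.cases ?_ (fun i => ?_) i
    · rw [extendPerm_zero, h0, hψ0]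
    · rw [extendPerm_succ]; exact hτ i
  choose c hc hcv using fun i => exists_smul_unitVec_of_lineParam_eq (hpar i)
  refine ⟨1, extendPerm τ, c, by simp, hc, fun i => ⟨?_, ?_⟩⟩
  · rw [hψ, hφ, Matrix.one_mulVec, hcv]
  · have hBtype : B.HasType m := hB.1
    refine Fin.cases ?_ (fun i => ?_) i
    · rw [extendPerm_zero, hBtype.1, hDtype.1]
    · rw [extendPerm_succ, hBtype.2, hDtype.2]

end BakerAkhiezer

theorem theorem2p6 (m n : ℕ) (hm : 1 ≤ m) :
    (∃ B : Configuration 2 n, B.IsAm1n m) ∧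
    ∀ B : Configuration 2 n, B.IsAm1n m →
      ∀ A : Configuration 2 n, A.HasType m → (A.AdmitsBA ↔ A.Equivalent B) :=
  ⟨BakerAkhiezer.exists_isAm1n m n hm, fun _ hB _ hA =>
    ⟨BakerAkhiezer.equivalent_of_admitsBA hm hB hA, fun h =>
      BakerAkhiezer.admitsBA_of_equivalent h (BakerAkhiezer.admitsBA_of_isAm1n hm hB)⟩⟩
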